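/- Let $v_1,\dots,v_n\in\mathbb R^3$ ($n\ge 3$) be the vertices, all extremal and listed in counter-clockwise order so that $\det(v_i,v_j,v_k)>0$ for $i<j<k$, of a convex polygon $P$ lying in a plane that does not pass through the origin. (For instance $P$ may be a toric diagram, that is, a convex polygon whose vertices are of the form $(*,*,1)\in\mathbb Z^3$.) For $\phi=(\phi^1,\dots,\phi^n)\in\mathbb R^n$ put $$\hat F_P(\phi)=\sum_{1\le i<j<k\le n}|\det(v_i,v_j,v_k)|\,\phi^i\phi^j\phi^k .$$ For $\phi\in\mathbb R_{\ge 0}^n$ let $\mathcal Z_P(\phi)=\phi^1\,\mathrm{conv}(0,v_1)+\dots+\phi^n\,\mathrm{conv}(0,v_n)$ (Minkowski sum). Fix $r>0$, and let $\Gamma_n=\{\phi\in\mathbb R_{\ge0}^n:\sum_i\phi^i=r\}$ and $\mathrm{relint}(\Gamma_n)=\{\phi\in\Gamma_n:\phi^i>0\text{ for all }i\}$. Let $F_P$ be the restriction of $\hat F_P$ to $\Gamma_n$. A point of $\Gamma_n$ is called a critical point of $F_P$ if the derivative of $\hat F_P$ there vanishes on all vectors $w$ with $\sum_i w^i=0$.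 The $n$ vertices of the simplex $\Gamma_n$, where $\hat F_P$ and all its first derivatives vanish, are not counted as critical points. Then: 1. For all $\phi\in\mathbb R_{\ge0}^n$, $\hat F_P(\phi)=\mathrm{vol}(\mathcal Z_P(\phi))\ge 0$, and the function $\phi\mapsto \hat F_P(\phi)^{1/3}=\mathrm{vol}(\mathcal Z_P(\phi))^{1/3}$ is concave on $\mathbb R_{\ge 0}^n$. 2. If $a\ne b$ are points of $\Gamma_n$ that do not lie on a common edge of the simplex $\Gamma_n$, and $0<t<1$, then $$\hat F_P((1-t)a+tb)^{1/3}>(1-t)\hat F_P(a)^{1/3}+t\hat F_P(b)^{1/3}.$$ (On each edge of $\Gamma_n$ the function vanishes identically.) In particular $F_P^{1/3}$ is strictly concave on the set $\{\phi\in\Gamma_n: F_P(\phi)>0\}$, which contains $\mathrm{relint}(\Gamma_n)$. 3. Suppose that $\phi_*\in\Gamma_n$ is a critical point or a local maximum of $F_P:\Gamma_n\to\mathbb R$. Then $\phi_*$ lies in $\mathrm{relint}(\Gamma_n)$, it is the unique critical point and the unique local maximum of $F_P$, and it is the strict global maximum: $F_P(\psi)<F_P(\phi_*)$ for all $\psi\in\Gamma_n$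 with $\psi\ne\phi_*$. -/

import Mathlib

open MeasureTheory
open scoped Pointwise Matrix

noncomputable section

namespace ToricZonotope

/-- The bracket `⟨u, v, w⟩`: the determinant of the `3 × 3` matrix with columns `u`, `v`, `w`. -/
def bracket (u v w : Fin 3 → ℝ) : ℝ :=
  (Matrix.of ![u, v, w])ᵀ.det

/-- `v 0, …, v (n - 1)` are the vertices of a (nondegenerate) convex polygon with `n ≥ 3` vertices,
all of them extremal, lying in a plane `{x | ℓ x = 1}` that does not pass through the origin, and
listed in counter-clockwise order, i.e. every triple taken in increasing order is positively
oriented. -/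
structure IsConvexPolygon {n : ℕ} (v : Fin n → Fin 3 → ℝ) : Prop where
  three_le : 3 ≤ n
  plane : ∃ l : (Fin 3 → ℝ) →ₗ[ℝ] ℝ, ∀ i, l (v i) = 1
  ccw : ∀ i j k : Fin n, i < j → j < k → 0 < bracket (v i) (v j) (v k)

/-- `v 0, …, v (n - 1)` are the vertices, in counter-clockwise order, of a toric diagram: a convex
integral polygon placed at height one. -/
structure IsToricDiagram {n : ℕ} (v : Fin n → Fin 3 → ℝ) : Prop where
  three_le : 3 ≤ n
  height : ∀ i, v i 2 = 1
  integral : ∀ i c, ∃ m : ℤ, v i c = m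
  ccw : ∀ i j k : Fin n, i < j → j < k → 0 < bracket (v i) (v j) (v k)

/-- Toric diagrams are a special case of convex polygons in a plane missing the origin. -/
theorem IsToricDiagram.isConvexPolygon {n : ℕ} {v : Fin n → Fin 3 → ℝ} (h : IsToricDiagram v) :
    IsConvexPolygon v :=
  ⟨h.three_le, ⟨LinearMap.proj 2, fun i => h.height i⟩, h.ccw⟩

/-- The cubic form `∑_{i < j < k} |det (v i, v j, v k)| φ i φ j φ k`. -/
def Fhat {n : ℕ} (v : Fin n → Fin 3 → ℝ) (φ : Fin n → ℝ) : ℝ :=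
  ∑ i : Fin n, ∑ j ∈ Finset.Ioi i, ∑ k ∈ Finset.Ioi j,
    |bracket (v i) (v j) (v k)| * φ i * φ j * φ k

/-- The zonotope `φ 0 • conv (0, v 0) + … + φ (n - 1) • conv (0, v (n - 1))`, a Minkowski sum of
dilated segments. -/
def zonotope {n : ℕ} (v : Fin n → Fin 3 → ℝ) (φ : Fin n → ℝ) : Set (Fin 3 → ℝ) :=
  ∑ i : Fin n, φ i • segment ℝ 0 (v i)

/-- The closed nonnegative orthant of `ℝⁿ`. -/
def orthant (n : ℕ) : Set (Fin n → ℝ) :=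
  {φ | ∀ i, 0 ≤ φ i}

/-- The simplex `Γₙ` of nonnegative vectors with coordinate sum `r`. -/
def Gam (n : ℕ) (r : ℝ) : Set (Fin n → ℝ) :=
  {φ | (∀ i, 0 ≤ φ i) ∧ ∑ i, φ i = r}

/-- The relative interior of the simplex `Γₙ`. -/
def relintGam (n : ℕ) (r : ℝ) : Set (Fin n → ℝ) :=
  {φ | (∀ i, 0 < φ i) ∧ ∑ i, φ i = r}

/-- `φ` is a point of `Γₙ` at which the derivative of the cubic form vanishes in every direction
tangent to the affine hull of `Γₙ`. -/
def IsCritical {n : ℕ} (v : Fin n → Fin 3 → ℝ) (r : ℝ) (φ : Fin n → ℝ) : Prop :=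
  φ ∈ Gam n r ∧ ∀ w : Fin n → ℝ, ∑ i, w i = 0 → fderiv ℝ (Fhat v) φ w = 0

/-- `φ` is either a critical point of the restriction to `Γₙ` of the cubic form, other than one of
the `n` vertices of the simplex `Γₙ` (where the form and all its first derivatives vanish for
trivial reasons), or a local maximum of this restriction. -/
def IsCriticalOrLocalMax {n : ℕ} (v : Fin n → Fin 3 → ℝ) (r : ℝ) (φ : Fin n → ℝ) : Prop :=
  (IsCritical v r φ ∧ ∀ i, φ ≠ Pi.single i r) ∨ (φ ∈ Gam n r ∧ IsLocalMaxOn (Fhat v) (Gam n r) φ)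

/-- `a` and `b` lie on a common edge of the simplex `Γₙ`: all their coordinates vanish outside a
pair of indices. -/
def OnCommonEdge {n : ℕ} (a b : Fin n → ℝ) : Prop :=
  ∃ i j : Fin n, ∀ k, k ≠ i → k ≠ j → a k = 0 ∧ b k = 0

end ToricZonotope

end

namespace ToricZonotope

/-! ### Brackets and the trilinear form -/

/-! The cubic form is one sixth of the diagonal of the symmetric trilinear form `tri`, which up to
scale is the mixed volume of zonotopes with generators `v i`. Everything rests on the Hodge–Riemann
relation `tri_neg_of_orthogonal`: for positive `φ`, the form `tri v φ` is negative definite on the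
kernel of `tri v φ φ`. It is proved by the Bochner method. Since `tri v φ w w = ∑ k, φ k * quad v k
w w`, one descends to the planar forms `quad v k`. Projecting along `v k` and rescaling turns such a
form into the kernel `|x - y|` on a line, which is conditionally negative definite, so `quad v k`
satisfies a reverse Cauchy–Schwarz inequality at `φ`. Summed over `k`, this says that each
eigenvalue `μ` of `tri v φ`, relative to a suitable diagonal weight, satisfies `μ ≤ μ ^ 2`. A Perron
argument shows that eigenvalues at least 1 belong only to multiples of `φ`; zero is excluded by
definiteness; all others are negative.

Alexandrov–Fenchel inequalities follow, and multiplying two of them gives the tangent inequality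
`F(φ)² F(ψ) < (tri v φ φ ψ / 6)³` for `ψ` not proportional to `φ` and supported where `φ` is.
Applied at `φ = s a + t b`, with the linearity of `tri v φ φ`, it is the (strict) concavity of the
cube root.

At a critical point or local maximum `φ`, the first-order conditions bound `tri v φ φ ψ` by `tri v φ
φ φ`, so the tangent inequality makes `φ` the strict global maximum. That no coordinate of `φ`
vanishes is where convexity of the polygon enters (`lt_quad_of_eq_zero`): the gradient at a vertex
missing from the support would exceed its value on the support.

The volume formula is an induction on the generators: a new segment adds its determinant factor
times the volume of a projected zonotope one dimension lower. -/

theorem bracket_eq (u v w : Fin 3 → ℝ) :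
    bracket u v w = u 0 * (v 1 * w 2 - v 2 * w 1) - u 1 * (v 0 * w 2 - v 2 * w 0)
      + u 2 * (v 0 * w 1 - v 1 * w 0) := by
  simp [bracket, Matrix.det_fin_three]
  ring

theorem bracket_rotate (u v w : Fin 3 → ℝ) : bracket u v w = bracket v w u := by
  simp only [bracket_eq]; ring

theorem bracket_swap (u v w : Fin 3 → ℝ) : bracket u v w = -bracket u w v := by
  simp only [bracket_eq]; ring

theorem abs_bracket_swap_right (u v w : Fin 3 → ℝ) : |bracket u v w| = |bracket u w v| := by
  rw [bracket_swap, abs_neg]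

theorem abs_bracket_swap_left (u v w : Fin 3 → ℝ) : |bracket u v w| = |bracket v u w| := by
  rw [bracket_rotate, abs_bracket_swap_right]

@[simp] theorem bracket_self_left (u v : Fin 3 → ℝ) : bracket u u v = 0 := by
  simp only [bracket_eq]; ring

@[simp] theorem bracket_self_right (u v : Fin 3 → ℝ) : bracket u v v = 0 := by
  simp only [bracket_eq]; ring

@[simp] theorem bracket_self_outer (u v : Fin 3 → ℝ) : bracket u v u = 0 := by
  simp only [bracket_eq]; ring

/-- A family of vectors in space is in general position if any three of them are independent. -/
def GeneralPosition {ι : Type*} (v : ι → Fin 3 → ℝ) : Prop :=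
  ∀ i j k, i ≠ j → i ≠ k → j ≠ k → bracket (v i) (v j) (v k) ≠ 0

/-- The symmetric trilinear form `∑ |det (v i, v j, v k)| a i b j c k`, six times the
polarization of the cubic form. -/
def tri {ι : Type*} [Fintype ι] (v : ι → Fin 3 → ℝ) (a b c : ι → ℝ) : ℝ :=
  ∑ i, ∑ j, ∑ k, |bracket (v i) (v j) (v k)| * a i * b j * c k

/-! ### The kernel `|x - y|` is conditionally negative definite -/

section AbsKernel

variable {ι : Type*} [DecidableEq ι]

/-- The deficit equals the integral over `t ≤ M` of the square of `∑ c i` taken over `x i ≤ t`. The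
induction adds the points from left to right, so no integral is needed. -/
theorem abs_kernel_deficit_nonneg (x c : ι → ℝ) (s : Finset ι) (hx : Set.InjOn x s) :
    ∀ M, (∀ i ∈ s, x i ≤ M) →
      0 ≤ (∑ i ∈ s, c i) * (∑ i ∈ s, c i * (M - x i))
        - (∑ i ∈ s, ∑ j ∈ s, |x i - x j| * c i * c j) / 2 ∧
      ((∀ i ∈ s, x i < M) →
        (∑ i ∈ s, c i) * (∑ i ∈ s, c i * (M - x i))
          - (∑ i ∈ s, ∑ j ∈ s, |x i - x j| * c i * c j) / 2 = 0 → ∀ i ∈ s, c i = 0) := by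
  induction s using Finset.induction_on_max_value x with
  | empty => simp
  | insert p s hp hmax ih =>
    intro M hM
    have hx' : Set.InjOn x s := hx.mono (by simp)
    have hlt : ∀ i ∈ s, x i < x p := fun i hi =>
      lt_of_le_of_ne (hmax i hi) fun h => hp <| by
        have : i = p := hx (by simp [hi]) (by simp) h
        exact this ▸ hi
    obtain ⟨h0, h1⟩ := ih hx' (x p) hmax
    have hpM : x p ≤ M := hM p (by simp)
    set C := ∑ i ∈ s, c i with hC
    set A := ∑ i ∈ s, c i * (x p - x i) with hA
    set E := ∑ i ∈ s, ∑ j ∈ s, |x i - x j| * c i * c j with hE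
    have hA' : ∑ i ∈ s, c i * (M - x i) = A + (M - x p) * C := by
      rw [hA, hC, Finset.mul_sum, ← Finset.sum_add_distrib]
      exact Finset.sum_congr rfl fun i _ => by ring
    have hcross : ∑ j ∈ s, |x p - x j| * c p * c j = c p * A := by
      rw [hA, Finset.mul_sum]
      refine Finset.sum_congr rfl fun i hi => ?_
      rw [abs_of_nonneg (sub_nonneg.2 (hmax i hi))]; ring
    have hcross' : ∑ i ∈ s, |x i - x p| * c i * c p = c p * A := by
      rw [← hcross]
      exact Finset.sum_congr rfl fun i _ => by rw [abs_sub_comm]; ring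
    -- The deficit up to `x p`, plus the contribution of the last interval from `x p` to `M`, where
    -- the partial sum is constantly `c p + C`.
    have key : (∑ i ∈ insert p s, c i) * (∑ i ∈ insert p s, c i * (M - x i))
        - (∑ i ∈ insert p s, ∑ j ∈ insert p s, |x i - x j| * c i * c j) / 2
        = (C * A - E / 2) + (M - x p) * (c p + C) ^ 2 := by
      simp only [Finset.sum_insert hp, Finset.sum_add_distrib, hA', hcross, hcross', ← hC, ← hE]
      simp only [sub_self, abs_zero]
      ring
    rw [key]
    refine ⟨add_nonneg h0 (mul_nonneg (sub_nonneg.2 hpM) (sq_nonneg _)), fun hMs heq => ?_⟩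
    have hpM' : x p < M := hMs p (by simp)
    have h2 : 0 ≤ (M - x p) * (c p + C) ^ 2 := mul_nonneg (sub_nonneg.2 hpM) (sq_nonneg _)
    have h3 : C * A - E / 2 = 0 := by linarith
    have h4 : (M - x p) * (c p + C) ^ 2 = 0 := by linarith
    have h5 := h1 hlt h3
    have h6 : C = 0 := Finset.sum_eq_zero h5
    have h7 : c p = 0 := by
      rcases mul_eq_zero.1 h4 with h | h
      · linarith
      · have := pow_eq_zero_iff (two_ne_zero) |>.1 h
        linarith
    intro i hi
    rcases Finset.mem_insert.1 hi with rfl | hi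
    · exact h7
    · exact h5 i hi

theorem abs_kernel_nonpos (x c : ι → ℝ) (s : Finset ι) (hx : Set.InjOn x s)
    (hc : ∑ i ∈ s, c i = 0) :
    ∑ i ∈ s, ∑ j ∈ s, |x i - x j| * c i * c j ≤ 0 ∧
      (∑ i ∈ s, ∑ j ∈ s, |x i - x j| * c i * c j = 0 → ∀ i ∈ s, c i = 0) := by
  obtain ⟨M, hM⟩ : ∃ M, ∀ i ∈ s, x i < M := by
    obtain ⟨M, hM⟩ := (s.image x).bddAbove
    exact ⟨M + 1, fun i hi => by
      have := hM (Finset.mem_coe.2 (Finset.mem_image_of_mem x hi)); linarith⟩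
  obtain ⟨h0, h1⟩ := abs_kernel_deficit_nonneg x c s hx M fun i hi => (hM i hi).le
  rw [hc] at h0 h1
  exact ⟨by linarith, fun h => h1 hM (by rw [h]; ring)⟩

end AbsKernel

/-! ### The quadratic forms attached to the projections along the vectors -/

section Quadratic

variable {ι : Type*} [Fintype ι]

/-- The symmetric bilinear form `∑ |det (v k, v i, v j)| a i b j`. -/
def quad (v : ι → Fin 3 → ℝ) (k : ι) (a b : ι → ℝ) : ℝ :=
  ∑ i, ∑ j, |bracket (v k) (v i) (v j)| * a i * b j

theorem quad_comm (v : ι → Fin 3 → ℝ) (k : ι) (a b : ι → ℝ) : quad v k a b = quad v k b a := by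
  unfold quad
  rw [Finset.sum_comm]
  refine Finset.sum_congr rfl fun i _ => Finset.sum_congr rfl fun j _ => ?_
  rw [abs_bracket_swap_right]; ring

theorem quad_add_right (v : ι → Fin 3 → ℝ) (k : ι) (a b c : ι → ℝ) :
    quad v k a (b + c) = quad v k a b + quad v k a c := by
  simp only [quad, Pi.add_apply, mul_add, Finset.sum_add_distrib]

theorem quad_smul_right (v : ι → Fin 3 → ℝ) (k : ι) (t : ℝ) (a b : ι → ℝ) :
    quad v k a (t • b) = t * quad v k a b := by
  simp only [quad, Pi.smul_apply, smul_eq_mul, Finset.mul_sum]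
  exact Finset.sum_congr rfl fun i _ => Finset.sum_congr rfl fun j _ => by ring

theorem quad_add_left (v : ι → Fin 3 → ℝ) (k : ι) (a b c : ι → ℝ) :
    quad v k (a + b) c = quad v k a c + quad v k b c := by
  rw [quad_comm, quad_add_right, quad_comm v k c, quad_comm v k c]

theorem quad_smul_left (v : ι → Fin 3 → ℝ) (k : ι) (t : ℝ) (a b : ι → ℝ) :
    quad v k (t • a) b = t * quad v k a b := by
  rw [quad_comm, quad_smul_right, quad_comm]

theorem exists_ne_ne (h3 : 3 ≤ Fintype.card ι) (i j : ι) : ∃ k, k ≠ i ∧ k ≠ j := by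
  classical
  obtain ⟨k, hk⟩ : ∃ k, k ∉ ({i, j} : Finset ι) := by
    by_contra! h
    have := Finset.card_le_card (fun k _ => h k : Finset.univ ⊆ ({i, j} : Finset ι))
    have h2 := Finset.card_le_two (a := i) (b := j)
    rw [Finset.card_univ] at this
    omega
  exact ⟨k, by simpa [not_or] using hk⟩

/-- Up to a rescaling, `quad v k` is the kernel `|x - y|` at distinct points of the line. -/
theorem exists_abs_kernel (v : ι → Fin 3 → ℝ) (hv : GeneralPosition v)
    (h3 : 3 ≤ Fintype.card ι) (k : ι) :
    ∃ (m x : ι → ℝ) (D : ℝ), 0 < D ∧ m k = 0 ∧ (∀ i, i ≠ k → 0 < m i) ∧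
      (∀ i j, i ≠ k → j ≠ k → i ≠ j → x i ≠ x j) ∧
      ∀ i j, i ≠ k → j ≠ k → D * |bracket (v k) (v i) (v j)| = |x i - x j| * m i * m j := by
  let f : {i // i ≠ k} → Module.Dual ℝ (Fin 3 → ℝ) := fun i =>
    { toFun := fun y => bracket (v k) y (v i)
      map_add' := fun y z => by simp only [bracket_eq, Pi.add_apply]; ring
      map_smul' := fun t y => by
        simp only [bracket_eq, Pi.smul_apply, smul_eq_mul, RingHom.id_apply]; ring }
  -- A generic `y`, avoiding the finitely many planes spanned by `v k` and `v i`. It serves as point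
  -- at infinity on the projective line of directions modulo `v k`.
  obtain ⟨y, -, hy⟩ := Module.Dual.exists_forall_mem_ne_zero_of_forall_exists ⊤ f (by
    intro i
    obtain ⟨j, hji, hjk⟩ := exists_ne_ne h3 i k
    exact ⟨v j, trivial, hv k j i hjk.symm i.2.symm hji⟩)
  have hy' : ∀ i, i ≠ k → bracket (v k) y (v i) ≠ 0 := fun i hi => hy ⟨i, hi⟩
  obtain ⟨l, hl, -⟩ := exists_ne_ne h3 k k
  -- The three-term Plücker relation. Divided by the brackets with `y`, it exhibits the bracket as a
  -- difference of affine coordinates.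
  have plu : ∀ i j, bracket (v k) y (v l) * bracket (v k) (v i) (v j)
      = bracket (v k) y (v i) * bracket (v k) (v l) (v j)
        - bracket (v k) y (v j) * bracket (v k) (v l) (v i) := fun i j => by
    simp only [bracket_eq]; ring
  have plu' : ∀ i j, i ≠ k → j ≠ k → bracket (v k) y (v l) * bracket (v k) (v i) (v j)
      = (bracket (v k) (v l) (v j) / bracket (v k) y (v j)
        - bracket (v k) (v l) (v i) / bracket (v k) y (v i))
        * bracket (v k) y (v i) * bracket (v k) y (v j) := fun i j hi hj => by
    have h1 := hy' i hi
    have h2 := hy' j hj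
    rw [plu]
    field_simp
  refine ⟨fun i => |bracket (v k) y (v i)|,
    fun i => bracket (v k) (v l) (v i) / bracket (v k) y (v i), |bracket (v k) y (v l)|,
    abs_pos.2 (hy' l hl), by simp, fun i hi => abs_pos.2 (hy' i hi), ?_, ?_⟩
  · intro i j hi hj hij heq
    have h := plu' i j hi hj
    simp only at heq
    rw [heq, sub_self, zero_mul, zero_mul] at h
    exact (mul_ne_zero (hy' l hl) (hv k i j hi.symm hj.symm hij)) h
  · intro i j hi hj
    rw [← abs_mul, plu' i j hi hj, abs_mul, abs_mul, abs_sub_comm]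

theorem quad_pos (v : ι → Fin 3 → ℝ) (hv : GeneralPosition v)
    (h3 : 3 ≤ Fintype.card ι) (k : ι) {φ : ι → ℝ} (hφ : ∀ i, 0 < φ i) : 0 < quad v k φ φ := by
  obtain ⟨i, hi, -⟩ := exists_ne_ne h3 k k
  obtain ⟨j, hj, hij⟩ := exists_ne_ne h3 k i
  have hnn : ∀ i j, 0 ≤ |bracket (v k) (v i) (v j)| * φ i * φ j := fun i j =>
    mul_nonneg (mul_nonneg (abs_nonneg _) (hφ i).le) (hφ j).le
  refine Finset.sum_pos' (fun i _ => Finset.sum_nonneg fun j _ => hnn i j)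
    ⟨i, Finset.mem_univ _, Finset.sum_pos' (fun j _ => hnn i j) ⟨j, Finset.mem_univ _, ?_⟩⟩
  exact mul_pos (mul_pos (abs_pos.2 (hv k i j hi.symm hj.symm hij.symm)) (hφ i)) (hφ j)

/-- The form `quad v k` has one positive direction and is negative definite on the complement,
apart from the coordinate `k`, which does not occur in it. -/
theorem quad_nonpos_of_orthogonal (v : ι → Fin 3 → ℝ) (hv : GeneralPosition v)
    (h3 : 3 ≤ Fintype.card ι) (k : ι) {φ : ι → ℝ} (hφ : ∀ i, 0 < φ i) (w : ι → ℝ)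
    (hw : quad v k φ w = 0) :
    quad v k w w ≤ 0 ∧ (quad v k w w = 0 → ∀ i, i ≠ k → w i = 0) := by
  classical
  obtain ⟨m, x, D, hD, hmk, hm, hx, hK⟩ := exists_abs_kernel v hv h3 k
  have hform : ∀ u : ι → ℝ, D * quad v k u u
      = ∑ i ∈ Finset.univ.erase k, ∑ j ∈ Finset.univ.erase k,
          |x i - x j| * (m i * u i) * (m j * u j) := by
    intro u
    unfold quad
    rw [← Finset.sum_erase Finset.univ (a := k) (by simp), Finset.mul_sum]
    refine Finset.sum_congr rfl fun i hi => ?_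
    rw [← Finset.sum_erase Finset.univ (a := k) (by simp), Finset.mul_sum]
    refine Finset.sum_congr rfl fun j hj => ?_
    have := hK i j (Finset.ne_of_mem_erase hi) (Finset.ne_of_mem_erase hj)
    linear_combination (u i * u j) * this
  have hneg : ∀ u : ι → ℝ, ∑ i ∈ Finset.univ.erase k, m i * u i = 0 →
      quad v k u u ≤ 0 ∧ (quad v k u u = 0 → ∀ i, i ≠ k → u i = 0) := by
    intro u hu
    obtain ⟨h0, h1⟩ := abs_kernel_nonpos x (fun i => m i * u i) (Finset.univ.erase k)
      (fun i hi j hj h => by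
        by_contra hne
        exact hx i j (Finset.ne_of_mem_erase hi) (Finset.ne_of_mem_erase hj) hne h) hu
    rw [← hform] at h0 h1
    refine ⟨nonpos_of_mul_nonpos_right h0 hD, fun h i hi => ?_⟩
    have := h1 (by rw [h, mul_zero]) i (by simp [hi])
    exact (mul_eq_zero.1 this).resolve_left (hm i hi).ne'
  obtain ⟨l, hl, -⟩ := exists_ne_ne h3 k k
  have hmφ : 0 < ∑ i ∈ Finset.univ.erase k, m i * φ i :=
    Finset.sum_pos (fun i hi => mul_pos (hm i (Finset.ne_of_mem_erase hi)) (hφ i))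
      ⟨l, by simp [hl]⟩
  -- The multiple of `φ` whose subtraction moves `w` into the hyperplane where the kernel is
  -- negative. Because `w` is orthogonal to `φ`, this only adds `t ^ 2 * quad v k φ φ ≥ 0` to the
  -- form.
  set t := (∑ i ∈ Finset.univ.erase k, m i * w i) / ∑ i ∈ Finset.univ.erase k, m i * φ i with ht
  have hu : ∑ i ∈ Finset.univ.erase k, m i * (w + (-t) • φ) i = 0 := by
    simp only [Pi.add_apply, Pi.smul_apply, smul_eq_mul, mul_add, Finset.sum_add_distrib]
    have : ∑ i ∈ Finset.univ.erase k, m i * (-t * φ i)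
        = -t * ∑ i ∈ Finset.univ.erase k, m i * φ i := by
      rw [Finset.mul_sum]
      exact Finset.sum_congr rfl fun i _ => by ring
    rw [this, ht]
    field_simp
    ring
  obtain ⟨h0, h1⟩ := hneg _ hu
  have hexp : quad v k (w + (-t) • φ) (w + (-t) • φ)
      = quad v k w w + t ^ 2 * quad v k φ φ := by
    simp only [quad_add_left, quad_add_right, quad_smul_left, quad_smul_right]
    rw [quad_comm v k w φ, hw]
    ring
  rw [hexp] at h0 h1
  have hpos := quad_pos v hv h3 k hφ
  have h2 : 0 ≤ t ^ 2 * quad v k φ φ := mul_nonneg (sq_nonneg _) hpos.le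
  refine ⟨by linarith, fun h i hi => ?_⟩
  have h3 : t ^ 2 * quad v k φ φ = 0 := by linarith
  have ht0 : t = 0 := pow_eq_zero_iff two_ne_zero |>.1 ((mul_eq_zero.1 h3).resolve_right hpos.ne')
  have := h1 (by rw [h, h3, add_zero]) i hi
  simpa [ht0] using this

/-- The form is nonpositive on the part of `w` orthogonal to `φ`. -/
theorem quad_reverse_cauchy_schwarz (v : ι → Fin 3 → ℝ) (hv : GeneralPosition v)
    (h3 : 3 ≤ Fintype.card ι) (k : ι) {φ : ι → ℝ} (hφ : ∀ i, 0 < φ i) (w : ι → ℝ) :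
    quad v k w w ≤ quad v k φ w ^ 2 / quad v k φ φ := by
  have hpos := quad_pos v hv h3 k hφ
  set t := quad v k φ w / quad v k φ φ with ht
  have h := (quad_nonpos_of_orthogonal v hv h3 k hφ (w + (-t) • φ) (by
    rw [quad_add_right, quad_smul_right, ht]; field_simp; ring)).1
  simp only [quad_add_left, quad_add_right, quad_smul_left, quad_smul_right] at h
  rw [quad_comm v k w φ] at h
  have h2 : quad v k φ w = t * quad v k φ φ := by rw [ht]; field_simp
  have h4 : quad v k φ w ^ 2 / quad v k φ φ = t * quad v k φ w := by rw [ht]; ring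
  rw [h4]
  linear_combination h + t * h2

end Quadratic

/-! ### Symmetric matrices with positive off-diagonal entries -/

section Perron

variable {ι : Type*} [Fintype ι]

/-- Simultaneous diagonalization of a symmetric matrix and a positive diagonal matrix. -/
theorem exists_weighted_eigenbasis (H : Matrix ι ι ℝ) (hH : ∀ i j, H i j = H j i)
    (d : ι → ℝ) (hd : ∀ i, 0 < d i) :
    ∃ (e : ι → ι → ℝ) (μ : ι → ℝ),
      (∀ j i, ∑ k, H i k * e j k = μ j * d i * e j i) ∧
      (∀ j, ∑ i, d i * e j i ^ 2 = 1) ∧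
      ∀ u w : ι → ℝ, ∑ i, d i * u i * w i
        = ∑ j, (∑ i, d i * u i * e j i) * ∑ i, d i * e j i * w i := by
  classical
  set s : ι → ℝ := fun i => √(d i) with hs
  have hs0 : ∀ i, 0 < s i := fun i => Real.sqrt_pos.2 (hd i)
  have hsd : ∀ i, s i * s i = d i := fun i => Real.mul_self_sqrt (hd i).le
  -- Conjugating by the square root of the weight reduces to the ordinary spectral theorem; the
  -- eigenvectors are divided by `s` on the way back.
  let M : Matrix ι ι ℝ := Matrix.of fun i j => H i j / (s i * s j)
  have hM : M.IsHermitian := by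
    ext i j
    simp only [M, Matrix.conjTranspose_apply, Matrix.of_apply, star_trivial]
    rw [hH j i, mul_comm]
  let b := hM.eigenvectorBasis
  have hb : ∀ j i, ∑ k, M i k * b j k = hM.eigenvalues j * b j i := fun j i => by
    have := congrFun (hM.mulVec_eigenvectorBasis j) i
    simpa [Matrix.mulVec, dotProduct] using this
  refine ⟨fun j i => b j i / s i, hM.eigenvalues, fun j i => ?_, fun j => ?_, fun u w => ?_⟩
  · have h := hb j i
    calc ∑ k, H i k * (b j k / s k) = s i * ∑ k, M i k * b j k := by
          rw [Finset.mul_sum]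
          refine Finset.sum_congr rfl fun k _ => ?_
          have h1 := (hs0 i).ne'
          have h2 := (hs0 k).ne'
          simp only [M, Matrix.of_apply]
          field_simp
      _ = hM.eigenvalues j * d i * (b j i / s i) := by
          rw [h, ← hsd]
          have h1 := (hs0 i).ne'
          field_simp
  · have h1 : inner ℝ (b j) (b j) = 1 := by simp
    rw [PiLp.inner_apply] at h1
    rw [← h1]
    refine Finset.sum_congr rfl fun i _ => ?_
    have h2 := (hs0 i).ne'
    rw [← hsd]
    simp only [RCLike.inner_apply, conj_trivial]
    field_simp
  · have h1 := b.sum_inner_mul_inner (WithLp.toLp 2 fun i => s i * u i)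
      (WithLp.toLp 2 fun i => s i * w i)
    simp only [PiLp.inner_apply, RCLike.inner_apply, conj_trivial] at h1
    convert h1.symm using 1
    · exact Finset.sum_congr rfl fun i _ => by rw [← hsd]; ring
    · refine Finset.sum_congr rfl fun j _ => ?_
      congr 1 <;> refine Finset.sum_congr rfl fun i _ => ?_
      · have h2 := (hs0 i).ne'
        rw [← hsd]
        field_simp
      · have h2 := (hs0 i).ne'
        rw [← hsd]
        field_simp

/-- A maximum principle. Let `c` be the maximum of `e / φ`, attained at `m`. Row `m` of `H` applied
to the nonnegative vector `c φ - e` gives `c p_m (1 - μ) ≤ 0`, so every term vanishes, and the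
positive off-diagonal entries force `e = c φ`. -/
theorem eq_smul_of_positive_entry (H : Matrix ι ι ℝ) (hpos : ∀ i j, i ≠ j → 0 < H i j)
    (hdiag : ∀ i, 0 ≤ H i i) {φ p : ι → ℝ} (hφ : ∀ i, 0 < φ i) (hp : ∀ i, ∑ j, H i j * φ j = p i)
    (hp0 : ∀ i, 0 < p i) {e : ι → ℝ} {μ : ℝ} (hμ : 1 ≤ μ)
    (he : ∀ i, ∑ j, H i j * e j = μ * (p i / φ i) * e i) (hex : ∃ i, 0 < e i) :
    ∃ c : ℝ, ∀ i, e i = c * φ i := by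
  obtain ⟨l, hl⟩ := hex
  obtain ⟨m, -, hm⟩ := Finset.exists_max_image Finset.univ (fun i => e i / φ i) ⟨l, by simp⟩
  set c := e m / φ m with hc
  have hem : e m = c * φ m := by have := (hφ m).ne'; rw [hc]; field_simp
  have hc0 : 0 < c := lt_of_lt_of_le (div_pos hl (hφ l)) (hm l (by simp))
  have hle : ∀ j, 0 ≤ c * φ j - e j := fun j => by
    have := (div_le_iff₀ (hφ j)).1 (hm j (by simp))
    linarith
  have hterm : ∀ j, 0 ≤ H m j * (c * φ j - e j) := fun j => by
    rcases eq_or_ne m j with rfl | h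
    · exact mul_nonneg (hdiag _) (hle _)
    · exact mul_nonneg (hpos _ _ h).le (hle _)
  have hsum : ∑ j, H m j * (c * φ j - e j) = c * p m * (1 - μ) := by
    have h1 : ∑ j, H m j * (c * φ j - e j) = c * ∑ j, H m j * φ j - ∑ j, H m j * e j := by
      rw [Finset.mul_sum, ← Finset.sum_sub_distrib]
      exact Finset.sum_congr rfl fun j _ => by ring
    rw [h1, hp, he, hem]
    have := (hφ m).ne'
    field_simp
  have hzero : ∑ j, H m j * (c * φ j - e j) = 0 :=
    le_antisymm (by
      rw [hsum]
      exact mul_nonpos_of_nonneg_of_nonpos (mul_pos hc0 (hp0 m)).le (by linarith))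
      (Finset.sum_nonneg fun j _ => hterm j)
  have hall := (Finset.sum_eq_zero_iff_of_nonneg fun j _ => hterm j).1 hzero
  refine ⟨c, fun j => ?_⟩
  rcases eq_or_ne m j with rfl | h
  · exact hem
  · have := (mul_eq_zero.1 (hall j (by simp))).resolve_left (hpos _ _ h).ne'
    linarith

/-- A symmetric matrix with positive off-diagonal entries satisfying a Bochner-type inequality at
a positive vector `φ` is negative definite on the orthogonal complement of `φ`. -/
theorem sum_neg_of_bochner (H : Matrix ι ι ℝ) (hH : ∀ i j, H i j = H j i)
    (hpos : ∀ i j, i ≠ j → 0 < H i j) (hdiag : ∀ i, 0 ≤ H i i) {φ p : ι → ℝ}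
    (hφ : ∀ i, 0 < φ i) (hp : ∀ i, ∑ j, H i j * φ j = p i) (hp0 : ∀ i, 0 < p i)
    (hbochner : ∀ w : ι → ℝ,
      ∑ i, w i * ∑ j, H i j * w j ≤ ∑ i, φ i * ((∑ j, H i j * w j) ^ 2 / p i))
    (hinj : ∀ w : ι → ℝ, (∀ i, ∑ j, H i j * w j = 0) → w = 0)
    {w : ι → ℝ} (hw : ∑ i, p i * w i = 0) (hw0 : w ≠ 0) :
    ∑ i, w i * ∑ j, H i j * w j < 0 := by
  have hd : ∀ i, 0 < p i / φ i := fun i => div_pos (hp0 i) (hφ i)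
  obtain ⟨e, μ, heig, hnorm, hpars⟩ := exists_weighted_eigenbasis H hH (fun i => p i / φ i) hd
  -- The form is diagonal in the eigenbasis; it remains to see that `w` has no component along any
  -- eigenvector with positive eigenvalue.
  have hform : ∑ i, w i * ∑ j, H i j * w j
      = ∑ j, μ j * (∑ i, p i / φ i * w i * e j i) ^ 2 := by
    have h1 := hpars w fun i => (∑ j, H i j * w j) / (p i / φ i)
    have h2 : ∑ i, w i * ∑ j, H i j * w j
        = ∑ i, p i / φ i * w i * ((∑ j, H i j * w j) / (p i / φ i)) := by
      refine Finset.sum_congr rfl fun i _ => ?_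
      have := (hd i).ne'
      rw [mul_comm (p i / φ i) (w i), mul_assoc, mul_div_cancel₀ _ this]
    rw [h2, h1]
    refine Finset.sum_congr rfl fun j _ => ?_
    have h3 : ∑ i, p i / φ i * e j i * ((∑ k, H i k * w k) / (p i / φ i))
        = μ j * ∑ i, p i / φ i * w i * e j i := by
      calc ∑ i, p i / φ i * e j i * ((∑ k, H i k * w k) / (p i / φ i))
          = ∑ i, ∑ k, H i k * w k * e j i := by
            refine Finset.sum_congr rfl fun i _ => ?_
            have := (hd i).ne'
            rw [mul_comm (p i / φ i) (e j i), mul_assoc, mul_div_cancel₀ _ this, mul_comm,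
              Finset.sum_mul]
        _ = ∑ k, w k * ∑ i, H k i * e j i := by
            rw [Finset.sum_comm]
            refine Finset.sum_congr rfl fun k _ => ?_
            rw [Finset.mul_sum]
            exact Finset.sum_congr rfl fun i _ => by rw [hH i k]; ring
        _ = μ j * ∑ i, p i / φ i * w i * e j i := by
            rw [Finset.mul_sum]
            exact Finset.sum_congr rfl fun k _ => by rw [heig]; ring
    rw [h3]; ring
  have hterm : ∀ j, (μ j < 0) ∨ ∑ i, p i / φ i * w i * e j i = 0 := by
    intro j
    have hne : e j ≠ 0 := fun h => by
      have := hnorm j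
      simp [h] at this
    have hμ0 : μ j ≠ 0 := fun h => hne (hinj _ fun i => by rw [heig, h]; ring)
    -- On a normalized eigenvector the Bochner inequality reads `μ ≤ μ ^ 2`, which rules out
    -- eigenvalues strictly between 0 and 1.
    have hb := hbochner (e j)
    have hl : ∑ i, e j i * ∑ k, H i k * e j k = μ j := by
      calc _ = μ j * ∑ i, p i / φ i * e j i ^ 2 := by
            rw [Finset.mul_sum]
            exact Finset.sum_congr rfl fun i _ => by rw [heig]; ring
        _ = μ j := by rw [hnorm, mul_one]
    have hr : ∑ i, φ i * ((∑ k, H i k * e j k) ^ 2 / p i) = μ j ^ 2 := by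
      calc _ = μ j ^ 2 * ∑ i, p i / φ i * e j i ^ 2 := by
            rw [Finset.mul_sum]
            refine Finset.sum_congr rfl fun i _ => ?_
            have h1 := (hφ i).ne'
            have h2 := (hp0 i).ne'
            rw [heig]
            field_simp
        _ = μ j ^ 2 := by rw [hnorm, mul_one]
    rw [hl, hr] at hb
    rcases lt_or_gt_of_ne hμ0 with h | h
    · exact Or.inl h
    · right
      have hμ1 : 1 ≤ μ j := by
        by_contra! hlt
        nlinarith
      obtain ⟨c, hc⟩ : ∃ c : ℝ, ∀ i, e j i = c * φ i := by
        by_cases hex : ∃ i, 0 < e j i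
        · exact eq_smul_of_positive_entry H hpos hdiag hφ hp hp0 hμ1 (heig j) hex
        · push Not at hex
          obtain ⟨i, hi⟩ : ∃ i, e j i ≠ 0 := by
            by_contra! hall
            exact hne (funext hall)
          obtain ⟨c, hc⟩ := eq_smul_of_positive_entry H hpos hdiag hφ hp hp0 (e := -e j) hμ1
            (fun i => by
              simp only [Pi.neg_apply, mul_neg, Finset.sum_neg_distrib, heig])
            ⟨i, by have := lt_of_le_of_ne (hex i) hi; simpa using this⟩
          refine ⟨-c, fun i => ?_⟩
          have := hc i
          simp only [Pi.neg_apply] at this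
          linarith
      calc ∑ i, p i / φ i * w i * e j i = c * ∑ i, p i * w i := by
            rw [Finset.mul_sum]
            refine Finset.sum_congr rfl fun i _ => ?_
            have h1 := (hφ i).ne'
            rw [hc]
            field_simp
        _ = 0 := by rw [hw, mul_zero]
  rw [hform]
  have hnp : ∀ j ∈ Finset.univ, μ j * (∑ i, p i / φ i * w i * e j i) ^ 2 ≤ 0 := fun j _ => by
    rcases hterm j with h | h
    · exact mul_nonpos_of_nonpos_of_nonneg h.le (sq_nonneg _)
    · simp [h]
  refine lt_of_le_of_ne (Finset.sum_nonpos hnp) fun h0 => hw0 ?_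
  have hall := (Finset.sum_eq_zero_iff_of_nonpos hnp).1 h0
  have hc0 : ∀ j, ∑ i, p i / φ i * w i * e j i = 0 := fun j => by
    rcases hterm j with h | h
    · exact pow_eq_zero_iff two_ne_zero |>.1
        ((mul_eq_zero.1 (hall j (Finset.mem_univ j))).resolve_left h.ne)
    · exact h
  have hz : ∑ i, p i / φ i * w i * w i = 0 := by
    rw [hpars]
    exact Finset.sum_eq_zero fun j _ => by rw [hc0, zero_mul]
  have hz' := (Finset.sum_eq_zero_iff_of_nonneg fun i _ => by
    rw [mul_assoc]; exact mul_nonneg (hd i).le (mul_self_nonneg (w i))).1 hz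
  funext i
  have := hz' i (Finset.mem_univ i)
  rw [mul_assoc] at this
  exact mul_self_eq_zero.1 ((mul_eq_zero.1 this).resolve_left (hd i).ne')

end Perron

/-! ### Mixed volume inequalities for the trilinear form -/

section Tri

variable {ι : Type*} [Fintype ι] (v : ι → Fin 3 → ℝ)

theorem tri_swap_left (a b c : ι → ℝ) : tri v a b c = tri v b a c := by
  unfold tri
  rw [Finset.sum_comm]
  refine Finset.sum_congr rfl fun i _ => Finset.sum_congr rfl fun j _ =>
    Finset.sum_congr rfl fun k _ => ?_
  rw [abs_bracket_swap_left]; ring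

theorem tri_swap_right (a b c : ι → ℝ) : tri v a b c = tri v a c b := by
  unfold tri
  refine Finset.sum_congr rfl fun i _ => ?_
  rw [Finset.sum_comm]
  refine Finset.sum_congr rfl fun j _ => Finset.sum_congr rfl fun k _ => ?_
  rw [abs_bracket_swap_right]; ring

theorem tri_eq_sum_quad (a b c : ι → ℝ) : tri v a b c = ∑ k, a k * quad v k b c := by
  unfold tri quad
  simp only [Finset.mul_sum]
  exact Finset.sum_congr rfl fun i _ => Finset.sum_congr rfl fun j _ =>
    Finset.sum_congr rfl fun k _ => by ring

theorem tri_add_right (a b c d : ι → ℝ) : tri v a b (c + d) = tri v a b c + tri v a b d := by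
  simp only [tri_eq_sum_quad, quad_add_right, mul_add, Finset.sum_add_distrib]

theorem tri_smul_right (t : ℝ) (a b c : ι → ℝ) : tri v a b (t • c) = t * tri v a b c := by
  simp only [tri_eq_sum_quad, quad_smul_right, Finset.mul_sum]
  exact Finset.sum_congr rfl fun i _ => by ring

theorem tri_add_mid (a b c d : ι → ℝ) : tri v a (b + c) d = tri v a b d + tri v a c d := by
  rw [tri_swap_right, tri_add_right, tri_swap_right v a b, tri_swap_right v a c]

theorem tri_smul_mid (t : ℝ) (a b c : ι → ℝ) : tri v a (t • b) c = t * tri v a b c := by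
  rw [tri_swap_right, tri_smul_right, tri_swap_right v a b]

theorem tri_add_left (a b c d : ι → ℝ) : tri v (a + b) c d = tri v a c d + tri v b c d := by
  rw [tri_swap_left, tri_add_mid, tri_swap_left v a, tri_swap_left v b]

theorem tri_smul_left (t : ℝ) (a b c : ι → ℝ) : tri v (t • a) b c = t * tri v a b c := by
  rw [tri_swap_left, tri_smul_mid, tri_swap_left v a]

/-- Expansion of the cubic form along a line. -/
theorem tri_line (a b : ι → ℝ) (t : ℝ) :
    tri v (a + t • b) (a + t • b) (a + t • b)
      = tri v a a a + 3 * t * tri v a a b + 3 * t ^ 2 * tri v a b b + t ^ 3 * tri v b b b := by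
  simp only [tri_add_left, tri_add_mid, tri_add_right, tri_smul_left, tri_smul_mid, tri_smul_right]
  rw [tri_swap_right v a b a, tri_swap_left v b a a, tri_swap_right v a b a, tri_swap_left v b a b,
    tri_swap_right v b b a, tri_swap_left v b a b]
  ring

theorem tri_nonneg {a b c : ι → ℝ} (ha : ∀ i, 0 ≤ a i) (hb : ∀ i, 0 ≤ b i) (hc : ∀ i, 0 ≤ c i) :
    0 ≤ tri v a b c :=
  Finset.sum_nonneg fun i _ => Finset.sum_nonneg fun j _ => Finset.sum_nonneg fun k _ =>
    mul_nonneg (mul_nonneg (mul_nonneg (abs_nonneg _) (ha i)) (hb j)) (hc k)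

theorem tri_pos_of_ne (hv : GeneralPosition v) {a b c : ι → ℝ} (ha : ∀ i, 0 ≤ a i)
    (hb : ∀ i, 0 ≤ b i) (hc : ∀ i, 0 ≤ c i) {i j k : ι} (hij : i ≠ j) (hik : i ≠ k) (hjk : j ≠ k)
    (hai : a i ≠ 0) (hbj : b j ≠ 0) (hck : c k ≠ 0) : 0 < tri v a b c := by
  have hnn : ∀ i j k, 0 ≤ |bracket (v i) (v j) (v k)| * a i * b j * c k := fun i j k =>
    mul_nonneg (mul_nonneg (mul_nonneg (abs_nonneg _) (ha i)) (hb j)) (hc k)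
  refine Finset.sum_pos' (fun i _ => Finset.sum_nonneg fun j _ => Finset.sum_nonneg fun k _ =>
    hnn i j k) ⟨i, Finset.mem_univ _, Finset.sum_pos' (fun j _ => Finset.sum_nonneg fun k _ =>
    hnn i j k) ⟨j, Finset.mem_univ _, Finset.sum_pos' (fun k _ => hnn i j k)
    ⟨k, Finset.mem_univ _, ?_⟩⟩⟩
  exact mul_pos (mul_pos (mul_pos (abs_pos.2 (hv i j k hij hik hjk)) ((ha i).lt_of_ne' hai))
    ((hb j).lt_of_ne' hbj)) ((hc k).lt_of_ne' hck)

theorem exists_three_of_tri_ne_zero {a : ι → ℝ} (h : tri v a a a ≠ 0) :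
    ∃ i j k, i ≠ j ∧ i ≠ k ∧ j ≠ k ∧ a i ≠ 0 ∧ a j ≠ 0 ∧ a k ≠ 0 := by
  obtain ⟨i, -, hi⟩ := Finset.exists_ne_zero_of_sum_ne_zero h
  obtain ⟨j, -, hj⟩ := Finset.exists_ne_zero_of_sum_ne_zero hi
  obtain ⟨k, -, hk⟩ := Finset.exists_ne_zero_of_sum_ne_zero hj
  refine ⟨i, j, k, ?_, ?_, ?_, ?_, ?_, ?_⟩ <;> rintro h
  · simp [h] at hk
  · simp [h] at hk
  · simp [h] at hk
  · simp [h] at hk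
  · simp [h] at hk
  · simp [h] at hk

variable {v}

/-- The Hodge–Riemann relation for the form `tri v φ`. -/
theorem tri_neg_of_orthogonal (hv : GeneralPosition v) (h3 : 3 ≤ Fintype.card ι) {φ : ι → ℝ}
    (hφ : ∀ i, 0 < φ i) {w : ι → ℝ} (hw : tri v φ φ w = 0) (hw0 : w ≠ 0) : tri v φ w w < 0 := by
  classical
  let H : Matrix ι ι ℝ := Matrix.of fun i j => ∑ k, |bracket (v i) (v k) (v j)| * φ k
  have hHw : ∀ u i, ∑ j, H i j * u j = quad v i φ u := fun u i => by
    simp only [H, quad, Matrix.of_apply, Finset.sum_mul]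
    rw [Finset.sum_comm]
  have htri : ∀ u, ∑ i, u i * quad v i φ u = tri v φ u u := fun u => by
    rw [← tri_eq_sum_quad, tri_swap_left]
  have h := sum_neg_of_bochner H (φ := φ) (p := fun i => quad v i φ φ) (w := w)
    (fun i j => by
      simp only [H, Matrix.of_apply]
      refine Finset.sum_congr rfl fun k _ => ?_
      rw [← bracket_rotate, abs_bracket_swap_right])
    (fun i j hij => by
      obtain ⟨k, hki, hkj⟩ := exists_ne_ne h3 i j
      refine Finset.sum_pos' (fun k _ => mul_nonneg (abs_nonneg _) (hφ k).le)
        ⟨k, Finset.mem_univ _, mul_pos (abs_pos.2 (hv i k j hki.symm hij hkj)) (hφ k)⟩)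
    (fun i => Finset.sum_nonneg fun k _ => mul_nonneg (abs_nonneg _) (hφ k).le)
    hφ (hHw φ) (fun i => quad_pos v hv h3 i hφ)
    (fun u => by
      simp only [hHw]
      rw [htri, tri_eq_sum_quad]
      exact Finset.sum_le_sum fun k _ =>
        mul_le_mul_of_nonneg_left (quad_reverse_cauchy_schwarz v hv h3 k hφ u) (hφ k).le)
    -- A kernel vector `u` is orthogonal to `φ` for every `quad v k`, so each `quad v k u u` is
    -- nonpositive. Their weighted sum vanishes, hence so does each of them. Coordinate `i` of `u`
    -- is then killed by any `k ≠ i`.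
    (fun u hu => by
      simp only [hHw] at hu
      have h0 : ∑ k, φ k * quad v k u u = 0 := by
        rw [← tri_eq_sum_quad, ← htri]
        exact Finset.sum_eq_zero fun i _ => by rw [hu, mul_zero]
      have hnp : ∀ k, quad v k u u ≤ 0 := fun k =>
        (quad_nonpos_of_orthogonal v hv h3 k hφ u (hu k)).1
      have hall := (Finset.sum_eq_zero_iff_of_nonpos fun k _ =>
        mul_nonpos_of_nonneg_of_nonpos (hφ k).le (hnp k)).1 h0
      funext i
      obtain ⟨k, hk, -⟩ := exists_ne_ne h3 i i
      exact (quad_nonpos_of_orthogonal v hv h3 k hφ u (hu k)).2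
        ((mul_eq_zero.1 (hall k (Finset.mem_univ k))).resolve_left (hφ k).ne') i hk.symm)
    (by
      rw [← hw, tri_swap_right, tri_swap_left, tri_eq_sum_quad]
      exact Finset.sum_congr rfl fun i _ => mul_comm _ _)
    hw0
  simpa only [hHw, htri] using h

theorem tri_pos_of_card (hv : GeneralPosition v) (h3 : 3 ≤ Fintype.card ι) {φ : ι → ℝ}
    (hφ : ∀ i, 0 < φ i) : 0 < tri v φ φ φ := by
  obtain ⟨i, j, k, hij, hik, hjk⟩ := Fintype.two_lt_card_iff.1 h3
  exact tri_pos_of_ne v hv (fun i => (hφ i).le) (fun i => (hφ i).le) (fun i => (hφ i).le)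
    hij hik hjk (hφ i).ne' (hφ j).ne' (hφ k).ne'

/-- One Gram–Schmidt step for `tri v φ`, turning negativity on the complement of `φ` into an
inequality about `ψ`. -/
theorem tri_sub_projection {φ ψ : ι → ℝ} (hpos : 0 < tri v φ φ φ) :
    tri v φ φ (ψ + (-(tri v φ φ ψ / tri v φ φ φ)) • φ) = 0 ∧
    tri v φ φ φ * tri v φ (ψ + (-(tri v φ φ ψ / tri v φ φ φ)) • φ)
        (ψ + (-(tri v φ φ ψ / tri v φ φ φ)) • φ)
      = tri v φ φ φ * tri v φ ψ ψ - tri v φ φ ψ ^ 2 := by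
  simp only [tri_add_mid, tri_add_right, tri_smul_mid, tri_smul_right]
  rw [tri_swap_right v φ ψ φ]
  constructor <;> field_simp <;> ring

/-- A case of the Alexandrov–Fenchel inequality. -/
theorem tri_mul_le_sq (hv : GeneralPosition v) (h3 : 3 ≤ Fintype.card ι) {φ : ι → ℝ}
    (hφ : ∀ i, 0 < φ i) (ψ : ι → ℝ) : tri v φ φ φ * tri v φ ψ ψ ≤ tri v φ φ ψ ^ 2 := by
  have hpos := tri_pos_of_card hv h3 hφ
  obtain ⟨h1, h2⟩ := tri_sub_projection (ψ := ψ) hpos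
  set w := ψ + (-(tri v φ φ ψ / tri v φ φ φ)) • φ
  have : tri v φ w w ≤ 0 := by
    rcases eq_or_ne w 0 with h | h
    · have h0 : tri v φ 0 0 = 0 := by simp [tri]
      rw [h, h0]
    · exact (tri_neg_of_orthogonal hv h3 hφ h1 h).le
  have := mul_nonpos_of_nonneg_of_nonpos hpos.le this
  linarith

theorem tri_mul_lt_sq (hv : GeneralPosition v) (h3 : 3 ≤ Fintype.card ι) {φ : ι → ℝ}
    (hφ : ∀ i, 0 < φ i) {ψ : ι → ℝ} (hψ : ∀ c : ℝ, ψ ≠ c • φ) :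
    tri v φ φ φ * tri v φ ψ ψ < tri v φ φ ψ ^ 2 := by
  have hpos := tri_pos_of_card hv h3 hφ
  obtain ⟨h1, h2⟩ := tri_sub_projection (ψ := ψ) hpos
  set w := ψ + (-(tri v φ φ ψ / tri v φ φ φ)) • φ with hw
  have hw0 : w ≠ 0 := fun h => hψ (tri v φ φ ψ / tri v φ φ φ) (by
    rw [hw, neg_smul, ← sub_eq_add_neg, sub_eq_zero] at h
    exact h)
  have := mul_neg_of_pos_of_neg hpos (tri_neg_of_orthogonal hv h3 hφ h1 hw0)
  linarith

/-- This is `tri_mul_le_sq` with the roles exchanged. As `ψ` may have zero coordinates, it is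
applied at the positive vector `ψ + t • φ` and `t` tends to zero. -/
theorem tri_mul_le_sq_of_nonneg (hv : GeneralPosition v) (h3 : 3 ≤ Fintype.card ι)
    {φ ψ : ι → ℝ} (hφ : ∀ i, 0 < φ i) (hψ : ∀ i, 0 ≤ ψ i) :
    tri v φ φ ψ * tri v ψ ψ ψ ≤ tri v φ ψ ψ ^ 2 := by
  have h : ∀ t : ℝ, 0 < t → (tri v φ φ ψ + t * tri v φ φ φ) *
      (tri v ψ ψ ψ + 3 * t * tri v φ ψ ψ + 3 * t ^ 2 * tri v φ φ ψ + t ^ 3 * tri v φ φ φ)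
      ≤ (tri v φ ψ ψ + 2 * t * tri v φ φ ψ + t ^ 2 * tri v φ φ φ) ^ 2 := by
    intro t ht
    have hpos : ∀ i, 0 < (ψ + t • φ) i := fun i =>
      add_pos_of_nonneg_of_pos (hψ i) (mul_pos ht (hφ i))
    have := tri_mul_le_sq hv h3 hpos φ
    rw [tri_line] at this
    simp only [tri_add_left, tri_add_mid, tri_smul_left, tri_smul_mid] at this
    rw [tri_swap_right v ψ ψ φ, tri_swap_left v ψ φ ψ, tri_swap_left v ψ φ φ,
      tri_swap_right v φ ψ φ] at this
    nlinarith [this]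
  have hl : Filter.Tendsto (fun t : ℝ => (tri v φ φ ψ + t * tri v φ φ φ) *
      (tri v ψ ψ ψ + 3 * t * tri v φ ψ ψ + 3 * t ^ 2 * tri v φ φ ψ + t ^ 3 * tri v φ φ φ))
      (nhdsWithin 0 (Set.Ioi 0)) (nhds (tri v φ φ ψ * tri v ψ ψ ψ)) := by
    refine Filter.Tendsto.mono_left ?_ nhdsWithin_le_nhds
    refine (Continuous.tendsto' (by fun_prop) _ _ ?_)
    ring
  have hr : Filter.Tendsto (fun t : ℝ =>
      (tri v φ ψ ψ + 2 * t * tri v φ φ ψ + t ^ 2 * tri v φ φ φ) ^ 2)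
      (nhdsWithin 0 (Set.Ioi 0)) (nhds (tri v φ ψ ψ ^ 2)) := by
    refine Filter.Tendsto.mono_left ?_ nhdsWithin_le_nhds
    refine (Continuous.tendsto' (by fun_prop) _ _ ?_)
    ring
  exact le_of_tendsto_of_tendsto hl hr (Filter.eventually_of_mem self_mem_nhdsWithin h)

/-- Write `A`, `B`, `C`, `D` for the values of `tri` with zero, one, two, three arguments `ψ`. From
`A C < B²` and `B D ≤ C²` follows `A² B D ≤ A² C² < B⁴`, and `B > 0` cancels. -/
theorem tri_tangent_lt_of_pos (hv : GeneralPosition v) (h3 : 3 ≤ Fintype.card ι)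
    {φ ψ : ι → ℝ} (hφ : ∀ i, 0 < φ i) (hψ : ∀ i, 0 ≤ ψ i) (hne : ∀ c : ℝ, ψ ≠ c • φ) :
    tri v φ φ φ ^ 2 * tri v ψ ψ ψ < tri v φ φ ψ ^ 3 := by
  have h0 := tri_pos_of_card hv h3 hφ
  obtain ⟨k, hk⟩ : ∃ k, ψ k ≠ 0 := by
    by_contra! h
    exact hne 0 (by rw [zero_smul]; exact funext h)
  obtain ⟨i, hik, -⟩ := exists_ne_ne h3 k k
  obtain ⟨j, hjk, hji⟩ := exists_ne_ne h3 k i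
  have hφ' : ∀ i, 0 ≤ φ i := fun i => (hφ i).le
  have h1 : 0 < tri v φ φ ψ :=
    tri_pos_of_ne v hv hφ' hφ' hψ hji.symm hik hjk (hφ i).ne' (hφ j).ne' hk
  have h2 := tri_mul_lt_sq hv h3 hφ hne
  have h4 := tri_mul_le_sq_of_nonneg hv h3 hφ hψ
  have h5 : (tri v φ φ φ * tri v φ ψ ψ) ^ 2 < (tri v φ φ ψ ^ 2) ^ 2 :=
    pow_lt_pow_left₀ h2 (mul_nonneg h0.le (tri_nonneg v hφ' hψ hψ)) two_ne_zero
  have h6 := mul_le_mul_of_nonneg_left h4 (sq_nonneg (tri v φ φ φ))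
  refine lt_of_mul_lt_mul_left ?_ h1.le
  nlinarith

theorem sum_eq_sum_subtype (p : ι → Prop) [DecidablePred p] (f : ι → ℝ) (hf : ∀ i, ¬ p i → f i = 0) :
    ∑ i, f i = ∑ i : {i // p i}, f i := by
  rw [← Finset.sum_subtype (Finset.univ.filter p) (by simp) f, Finset.sum_filter_of_ne]
  intro i _ h
  by_contra hp
  exact h (hf i hp)

variable (v) in
theorem tri_restrict (p : ι → Prop) [DecidablePred p] {a b c : ι → ℝ} (ha : ∀ i, ¬ p i → a i = 0)
    (hb : ∀ i, ¬ p i → b i = 0) (hc : ∀ i, ¬ p i → c i = 0) :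
    tri v a b c = tri (fun i : {i // p i} => v i) (fun i => a i) (fun i => b i) (fun i => c i) := by
  unfold tri
  rw [sum_eq_sum_subtype p _ fun i hi => by simp [ha i hi]]
  refine Finset.sum_congr rfl fun i _ => ?_
  rw [sum_eq_sum_subtype p _ fun i hi => by simp [hb i hi]]
  refine Finset.sum_congr rfl fun j _ => ?_
  rw [sum_eq_sum_subtype p _ fun i hi => by simp [hc i hi]]

/-- The tangent hyperplane at `φ` of the cubic form strictly dominates it in all the directions
supported where `φ` is. -/
theorem tri_tangent_lt (hv : GeneralPosition v) {φ ψ : ι → ℝ} (hφ : ∀ i, 0 ≤ φ i)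
    (h3 : ∃ i j k, i ≠ j ∧ i ≠ k ∧ j ≠ k ∧ φ i ≠ 0 ∧ φ j ≠ 0 ∧ φ k ≠ 0) (hψ : ∀ i, 0 ≤ ψ i)
    (hsupp : ∀ i, φ i = 0 → ψ i = 0) (hne : ∀ c : ℝ, ψ ≠ c • φ) :
    tri v φ φ φ ^ 2 * tri v ψ ψ ψ < tri v φ φ ψ ^ 3 := by
  classical
  have hφ0 : ∀ i, ¬ (φ i ≠ 0) → φ i = 0 := fun i h => not_not.1 h
  have hψ0 : ∀ i, ¬ (φ i ≠ 0) → ψ i = 0 := fun i h => hsupp i (not_not.1 h)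
  -- Discarding the indices outside the support of `φ` makes `φ` strictly positive and keeps general
  -- position.
  rw [tri_restrict v (fun i => φ i ≠ 0) hφ0 hφ0 hφ0, tri_restrict v (fun i => φ i ≠ 0) hψ0 hψ0 hψ0,
    tri_restrict v (fun i => φ i ≠ 0) hφ0 hφ0 hψ0]
  obtain ⟨i, j, k, hij, hik, hjk, hi, hj, hk⟩ := h3
  refine tri_tangent_lt_of_pos ?_ ?_ (fun i => (hφ i).lt_of_ne' i.2) (fun i => hψ i) ?_
  · intro i j k hij hik hjk
    exact hv i j k (Subtype.coe_ne_coe.2 hij) (Subtype.coe_ne_coe.2 hik) (Subtype.coe_ne_coe.2 hjk)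
  · refine Fintype.two_lt_card_iff.2 ⟨⟨i, hi⟩, ⟨j, hj⟩, ⟨k, hk⟩, ?_, ?_, ?_⟩ <;> simpa
  · intro c h
    refine hne c (funext fun i => ?_)
    by_cases hi : φ i = 0
    · simp [hi, hsupp i hi]
    · exact congrFun h ⟨i, hi⟩

end Tri

/-! ### The volume of a zonotope -/

section Volume

theorem mem_segment_zero {E : Type*} [AddCommGroup E] [Module ℝ E] {u x : E} :
    x ∈ segment ℝ 0 u ↔ ∃ t : ℝ, (0 ≤ t ∧ t ≤ 1) ∧ t • u = x := by
  simp [segment_eq_image]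

theorem Icc_add_Icc_zero_one {a b : ℝ} (hab : a ≤ b) :
    {x | ∃ t : ℝ, (0 ≤ t ∧ t ≤ 1) ∧ x - t ∈ Set.Icc a b} = Set.Icc a (b + 1) := by
  ext x
  simp only [Set.mem_ofPred_eq, Set.mem_Icc]
  constructor
  · rintro ⟨t, ⟨h0, h1⟩, h2, h3⟩
    constructor <;> linarith
  · rintro ⟨h1, h2⟩
    rcases le_total x b with h | h
    · exact ⟨0, ⟨le_rfl, zero_le_one⟩, by linarith, by linarith⟩
    · exact ⟨x - b, ⟨by linarith, by linarith⟩, by linarith, by linarith⟩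

theorem volume_eq_lintegral_section {d : ℕ} {A : Set (Fin (d + 1) → ℝ)} (hA : MeasurableSet A) :
    volume A = ∫⁻ y : Fin d → ℝ, volume {x : ℝ | (Fin.cons x y : Fin (d + 1) → ℝ) ∈ A} := by
  let e := MeasurableEquiv.piFinSuccAbove (fun _ : Fin (d + 1) => ℝ) 0
  have he : MeasurePreserving e.symm :=
    (volume_preserving_piFinSuccAbove (fun _ : Fin (d + 1) => ℝ) 0).symm
  rw [← he.measure_preimage_equiv, Measure.volume_eq_prod,
    Measure.prod_apply_symm (e.symm.measurable hA)]
  refine lintegral_congr fun y => congrArg volume ?_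
  ext x
  simp [e, MeasurableEquiv.piFinSuccAbove, Fin.insertNthEquiv]

/-- Adding a unit segment in a coordinate direction to a compact convex set increases the volume by
the volume of the projection along that direction. -/
theorem volume_add_segment_single {d : ℕ} {K : Set (Fin (d + 1) → ℝ)} (hK : IsCompact K)
    (hconv : Convex ℝ K) :
    volume (K + segment ℝ 0 (Pi.single 0 1)) = volume K + volume (Fin.tail '' K) := by
  have hseg : IsCompact (segment ℝ (0 : Fin (d + 1) → ℝ) (Pi.single 0 1)) := by
    rw [segment_eq_image]
    exact isCompact_Icc.image (by fun_prop)
  have htail : IsCompact (Fin.tail '' K : Set (Fin d → ℝ)) :=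
    hK.image (continuous_pi fun i => continuous_apply _)
  rw [volume_eq_lintegral_section (hK.add hseg).measurableSet,
    volume_eq_lintegral_section hK.measurableSet, ← lintegral_indicator_one htail.measurableSet,
    ← lintegral_add_right _ (measurable_one.indicator htail.measurableSet)]
  refine lintegral_congr fun y => ?_
  have hcons : ∀ (x t : ℝ), (Fin.cons (x - t) y : Fin (d + 1) → ℝ)
      = Fin.cons x y - t • Pi.single 0 1 := fun x t => by
    ext i
    refine Fin.cases ?_ (fun i => ?_) i <;> simp
  -- Fubini along the direction of the segment: each nonempty section is a compact interval and
  -- grows by length 1, and empty sections stay empty.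
  have hsec : {x : ℝ | (Fin.cons x y : Fin (d + 1) → ℝ) ∈ K + segment ℝ 0 (Pi.single 0 1)}
      = {x | ∃ t : ℝ, (0 ≤ t ∧ t ≤ 1) ∧ x - t ∈ {x : ℝ | (Fin.cons x y : Fin (d + 1) → ℝ) ∈ K}} := by
    ext x
    simp only [Set.mem_ofPred_eq, Set.mem_add, mem_segment_zero]
    constructor
    · rintro ⟨z, hz, _, ⟨t, ht, rfl⟩, h⟩
      refine ⟨t, ht, ?_⟩
      rwa [hcons, ← h, add_sub_cancel_right]
    · rintro ⟨t, ht, h⟩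
      rw [hcons] at h
      exact ⟨_, h, _, ⟨t, ht, rfl⟩, sub_add_cancel _ _⟩
  rw [hsec]
  by_cases hy : y ∈ (Fin.tail '' K : Set (Fin d → ℝ))
  · rw [Set.indicator_of_mem hy]
    set I := {x : ℝ | (Fin.cons x y : Fin (d + 1) → ℝ) ∈ K} with hI
    have hne : I.Nonempty := by
      obtain ⟨z, hz, rfl⟩ := hy
      exact ⟨z 0, by rw [hI, Set.mem_ofPred_eq, Fin.cons_self_tail]; exact hz⟩
    have hIc : IsCompact I := by
      have : I = (fun z : Fin (d + 1) → ℝ => z 0) '' (K ∩ Fin.tail ⁻¹' {y}) := by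
        ext x
        constructor
        · intro hx
          exact ⟨Fin.cons x y, ⟨hx, by simp⟩, by simp⟩
        · rintro ⟨z, ⟨hz, hzy⟩, rfl⟩
          rw [Set.mem_preimage, Set.mem_singleton_iff] at hzy
          rw [hI, Set.mem_ofPred_eq, ← hzy, Fin.cons_self_tail]
          exact hz
      rw [this]
      exact (hK.inter_right (isClosed_singleton.preimage
        (continuous_pi fun i => continuous_apply _))).image (continuous_apply 0)
    have hIconv : Convex ℝ I := by
      intro a ha b hb s t hs ht hst
      have := hconv ha hb hs ht hst
      rw [hI, Set.mem_ofPred_eq]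
      convert this using 1
      ext i
      refine Fin.cases ?_ (fun i => ?_) i
      · simp
      · simp only [Fin.cons_succ, Pi.add_apply, Pi.smul_apply, smul_eq_mul]
        rw [← add_mul, hst, one_mul]
    have hIcc := eq_Icc_of_connected_compact (hIconv.isConnected hne) hIc
    have hle : sInf I ≤ sSup I := by
      rw [← Set.nonempty_Icc, ← hIcc]; exact hne
    rw [hIcc, Icc_add_Icc_zero_one hle, Real.volume_Icc, Real.volume_Icc, Pi.one_apply,
      ← ENNReal.ofReal_one, ← ENNReal.ofReal_add (sub_nonneg.2 hle) zero_le_one]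
    congr 1
    ring
  · rw [Set.indicator_of_notMem hy, add_zero]
    have hempty : ∀ x : ℝ, (Fin.cons x y : Fin (d + 1) → ℝ) ∉ K := fun x hx =>
      hy ⟨_, hx, by simp⟩
    simp [hempty]

variable {ι : Type*}

/-- The Minkowski sum of the segments joining the origin to the vectors `u i`. -/
def segmentSum {E : Type*} [AddCommGroup E] [Module ℝ E] (s : Finset ι) (u : ι → E) : Set E :=
  ∑ i ∈ s, segment ℝ 0 (u i)

theorem segmentSum_empty {E : Type*} [AddCommGroup E] [Module ℝ E] (u : ι → E) :
    segmentSum ∅ u = {0} := by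
  simp [segmentSum, Set.singleton_zero]

variable [DecidableEq ι]

section SegmentSum

variable {E F : Type*} [AddCommGroup E] [Module ℝ E] [AddCommGroup F] [Module ℝ F]

theorem segmentSum_insert {s : Finset ι} {p : ι} (hp : p ∉ s) (u : ι → E) :
    segmentSum (insert p s) u = segmentSum s u + segment ℝ 0 (u p) := by
  rw [segmentSum, Finset.sum_insert hp, add_comm]; rfl

theorem image_segmentSum (L : E →ₗ[ℝ] F) (s : Finset ι) (u : ι → E) :
    L '' segmentSum s u = segmentSum s fun i => L (u i) := by
  induction s using Finset.induction_on with
  | empty => simp [segmentSum_empty]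
  | insert p s hp ih =>
    rw [segmentSum_insert hp, segmentSum_insert hp, Set.image_add, ih]
    congr 1
    have := image_segment ℝ L.toAffineMap 0 (u p)
    simpa using this

theorem convex_segmentSum (s : Finset ι) (u : ι → E) : Convex ℝ (segmentSum s u) := by
  induction s using Finset.induction_on with
  | empty => simp [segmentSum_empty]
  | insert p s hp ih =>
    rw [segmentSum_insert hp]
    exact ih.add (convex_segment _ _)

theorem nonempty_segmentSum (s : Finset ι) (u : ι → E) : (segmentSum s u).Nonempty := by
  induction s using Finset.induction_on with
  | empty => simp [segmentSum_empty]
  | insert p s hp ih =>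
    rw [segmentSum_insert hp]
    exact ih.add ⟨0, left_mem_segment ℝ _ _⟩

end SegmentSum

theorem isCompact_segmentSum {d : ℕ} (s : Finset ι) (u : ι → Fin d → ℝ) :
    IsCompact (segmentSum s u) := by
  induction s using Finset.induction_on with
  | empty => simp [segmentSum_empty]
  | insert p s hp ih =>
    rw [segmentSum_insert hp, segment_eq_image]
    exact ih.add (isCompact_Icc.image (by fun_prop))

/-- The increment of the volume when a generator is added to a zonotope. -/
theorem volume_segmentSum_insert {d : ℕ} {s : Finset ι} {p : ι} (hp : p ∉ s)
    (u : ι → Fin (d + 1) → ℝ) :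
    (u p = 0 ∧ volume (segmentSum (insert p s) u) = volume (segmentSum s u)) ∨
    ∃ g : (Fin (d + 1) → ℝ) ≃ₗ[ℝ] (Fin (d + 1) → ℝ), g (Pi.single 0 1) = u p ∧
      volume (segmentSum (insert p s) u) = volume (segmentSum s u)
        + ENNReal.ofReal |LinearMap.det (g : (Fin (d + 1) → ℝ) →ₗ[ℝ] (Fin (d + 1) → ℝ))|
          * volume (segmentSum s fun i => Fin.tail (g.symm (u i))) := by
  rw [segmentSum_insert hp]
  by_cases hup : u p = 0
  · left
    simp [hup]
  right
  -- A linear change of variables makes the new generator the first basis vector, at the cost of the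
  -- factor `|det g|`.
  obtain ⟨A, hA⟩ := SeparatingDual.exists_continuousLinearEquiv_apply_eq (R := ℝ)
    (x := (Pi.single 0 1 : Fin (d + 1) → ℝ)) (y := u p) (by simp) hup
  let g : (Fin (d + 1) → ℝ) ≃ₗ[ℝ] (Fin (d + 1) → ℝ) := A.toLinearEquiv
  have hg : g (Pi.single 0 1) = u p := hA
  let G : (Fin (d + 1) → ℝ) →ₗ[ℝ] (Fin (d + 1) → ℝ) := g
  refine ⟨g, hg, ?_⟩
  let tl : (Fin (d + 1) → ℝ) →ₗ[ℝ] (Fin d → ℝ) := LinearMap.funLeft ℝ ℝ Fin.succ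
  have h1 : segmentSum s u = G '' segmentSum s fun i => g.symm (u i) := by
    rw [image_segmentSum]
    simp [G]
  have h2 : segment ℝ 0 (u p) = G '' segment ℝ 0 (Pi.single 0 1) := by
    have := image_segment ℝ G.toAffineMap 0 (Pi.single 0 1)
    simp only [LinearMap.coe_toAffineMap, map_zero] at this
    rw [this, ← hg]; rfl
  rw [h2, h1, ← Set.image_add, Measure.addHaar_image_linearMap, Measure.addHaar_image_linearMap,
    volume_add_segment_single (isCompact_segmentSum _ _) (convex_segmentSum _ _), mul_add]
  congr 2
  have h3 := image_segmentSum tl s fun i => g.symm (u i)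
  exact congrArg volume h3

theorem map_single_eq_det (g : (Fin 1 → ℝ) →ₗ[ℝ] (Fin 1 → ℝ)) :
    g (Pi.single 0 1) 0 = LinearMap.det g := by
  rw [← LinearMap.det_toMatrix', Matrix.det_fin_one, LinearMap.toMatrix'_apply]

theorem cross_map_two (g : (Fin 2 → ℝ) →ₗ[ℝ] (Fin 2 → ℝ)) (x y : Fin 2 → ℝ) :
    g x 0 * g y 1 - g x 1 * g y 0 = LinearMap.det g * (x 0 * y 1 - x 1 * y 0) := by
  have h : ∀ z, g z = (LinearMap.toMatrix' g) *ᵥ z := fun z => by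
    rw [← Matrix.toLin'_apply, Matrix.toLin'_toMatrix']
  rw [h x, h y, ← LinearMap.det_toMatrix', Matrix.det_fin_two]
  simp only [Matrix.mulVec, dotProduct, Fin.sum_univ_two]
  ring

theorem bracket_map (g : (Fin 3 → ℝ) →ₗ[ℝ] (Fin 3 → ℝ)) (x y z : Fin 3 → ℝ) :
    bracket (g x) (g y) (g z) = LinearMap.det g * bracket x y z := by
  have h : ∀ z, g z = (LinearMap.toMatrix' g) *ᵥ z := fun z => by
    rw [← Matrix.toLin'_apply, Matrix.toLin'_toMatrix']
  rw [h x, h y, h z, ← LinearMap.det_toMatrix', Matrix.det_fin_three]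
  simp only [bracket_eq, Matrix.mulVec, dotProduct, Fin.sum_univ_three]
  ring

theorem volume_segmentSum_one (s : Finset ι) (u : ι → Fin 1 → ℝ) :
    volume (segmentSum s u) = ENNReal.ofReal (∑ i ∈ s, |u i 0|) := by
  induction s using Finset.induction_on with
  | empty => simp [segmentSum_empty]
  | insert p s hp ih =>
    rw [Finset.sum_insert hp]
    rcases volume_segmentSum_insert hp u with ⟨h0, h⟩ | ⟨g, hg, h⟩
    · rw [h, ih, h0]
      simp
    · have h1 : volume (segmentSum s fun i => Fin.tail (g.symm (u i))) = 1 := by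
        rw [Subsingleton.eq_univ_of_nonempty (nonempty_segmentSum _ _), Measure.volume_pi_eq_dirac 0]
        simp
      have h2 : LinearMap.det (g : (Fin 1 → ℝ) →ₗ[ℝ] (Fin 1 → ℝ)) = u p 0 := by
        rw [← map_single_eq_det, ← hg]; rfl
      rw [h, ih, h1, mul_one, h2, add_comm, ENNReal.ofReal_add (abs_nonneg _)
        (Finset.sum_nonneg fun i _ => abs_nonneg _)]

theorem volume_segmentSum_two (s : Finset ι) (u : ι → Fin 2 → ℝ) :
    volume (segmentSum s u)
      = ENNReal.ofReal ((∑ i ∈ s, ∑ j ∈ s, |u i 0 * u j 1 - u i 1 * u j 0|) / 2) := by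
  induction s using Finset.induction_on with
  | empty => simp [segmentSum_empty]
  | insert p s hp ih =>
    have hsum : (∑ i ∈ insert p s, ∑ j ∈ insert p s, |u i 0 * u j 1 - u i 1 * u j 0|) / 2
        = (∑ i ∈ s, ∑ j ∈ s, |u i 0 * u j 1 - u i 1 * u j 0|) / 2
          + ∑ j ∈ s, |u p 0 * u j 1 - u p 1 * u j 0| := by
      have hc : ∑ j ∈ s, |u j 0 * u p 1 - u j 1 * u p 0|
          = ∑ j ∈ s, |u p 0 * u j 1 - u p 1 * u j 0| :=
        Finset.sum_congr rfl fun j _ => by rw [← abs_neg]; congr 1; ring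
      have hd : |u p 0 * u p 1 - u p 1 * u p 0| = 0 := by rw [mul_comm, sub_self, abs_zero]
      simp only [Finset.sum_insert hp, Finset.sum_add_distrib, hc, hd]
      ring
    rw [hsum]
    rcases volume_segmentSum_insert hp u with ⟨h0, h⟩ | ⟨g, hg, h⟩
    · rw [h, ih, h0]
      simp
    · rw [h, ih, volume_segmentSum_one, ← ENNReal.ofReal_mul (abs_nonneg _),
        ← ENNReal.ofReal_add (by positivity) (by positivity)]
      congr 2
      rw [Finset.mul_sum]
      refine Finset.sum_congr rfl fun j _ => ?_
      have h2 := cross_map_two g (Pi.single 0 1) (g.symm (u j))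
      simp only [LinearEquiv.coe_coe, hg, LinearEquiv.apply_symm_apply] at h2
      rw [h2, ← abs_mul]
      simp [Fin.tail]

/-- New triples contain `p` exactly once, in one of three positions; those with a repeated `p`
contribute zero. -/
theorem sum_insert_three {s : Finset ι} {p : ι} (hp : p ∉ s) (f : ι → ι → ι → ℝ)
    (hl : ∀ i j k, f i j k = f j i k) (hr : ∀ i j k, f i j k = f i k j)
    (h0 : ∀ i j, f i i j = 0) :
    ∑ i ∈ insert p s, ∑ j ∈ insert p s, ∑ k ∈ insert p s, f i j k
      = ∑ i ∈ s, ∑ j ∈ s, ∑ k ∈ s, f i j k + 3 * ∑ i ∈ s, ∑ j ∈ s, f p i j := by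
  have h1 : ∑ i ∈ s, ∑ k ∈ s, f i p k = ∑ i ∈ s, ∑ j ∈ s, f p i j :=
    Finset.sum_congr rfl fun i _ => Finset.sum_congr rfl fun j _ => hl _ _ _
  have h2 : ∑ i ∈ s, ∑ j ∈ s, f i j p = ∑ i ∈ s, ∑ j ∈ s, f p i j :=
    Finset.sum_congr rfl fun i _ => Finset.sum_congr rfl fun j _ => by rw [hr, hl]
  have h3 : ∀ i, f i p p = 0 := fun i => by rw [hl, hr, h0]
  have h4 : ∀ i, f p i p = 0 := fun i => by rw [hr, h0]
  simp only [Finset.sum_insert hp, Finset.sum_add_distrib, h1, h2, h3, h4, h0,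
    Finset.sum_const_zero]
  ring

theorem volume_segmentSum_three (s : Finset ι) (u : ι → Fin 3 → ℝ) :
    volume (segmentSum s u)
      = ENNReal.ofReal ((∑ i ∈ s, ∑ j ∈ s, ∑ k ∈ s, |bracket (u i) (u j) (u k)|) / 6) := by
  induction s using Finset.induction_on with
  | empty => simp [segmentSum_empty]
  | insert p s hp ih =>
    rw [sum_insert_three hp (fun i j k => |bracket (u i) (u j) (u k)|)
      (fun i j k => abs_bracket_swap_left _ _ _) (fun i j k => abs_bracket_swap_right _ _ _)
      (fun i j => by simp), add_div]
    rcases volume_segmentSum_insert hp u with ⟨h0, h⟩ | ⟨g, hg, h⟩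
    · rw [h, ih, h0]
      have hz : ∀ x y : Fin 3 → ℝ, bracket 0 x y = 0 := fun x y => by simp [bracket_eq]
      simp [hz]
    · rw [h, ih, volume_segmentSum_two, ← ENNReal.ofReal_mul (abs_nonneg _),
        ← ENNReal.ofReal_add (by positivity) (by positivity)]
      congr 2
      have hterm : ∀ i j, |bracket (u p) (u i) (u j)|
          = |LinearMap.det (g : (Fin 3 → ℝ) →ₗ[ℝ] (Fin 3 → ℝ))|
            * |Fin.tail (g.symm (u i)) 0 * Fin.tail (g.symm (u j)) 1
              - Fin.tail (g.symm (u i)) 1 * Fin.tail (g.symm (u j)) 0| := by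
        intro i j
        have h2 := bracket_map g (Pi.single 0 1) (g.symm (u i)) (g.symm (u j))
        simp only [LinearEquiv.coe_coe, hg, LinearEquiv.apply_symm_apply] at h2
        rw [h2, ← abs_mul]
        congr 2
        simp [Fin.tail, bracket_eq]
      simp only [hterm, ← Finset.mul_sum]
      ring

end Volume

/-! ### The cubic form of a convex polygon -/

theorem sum_eq_six_mul_sum_Ioi {n : ℕ} (g : Fin n → Fin n → Fin n → ℝ)
    (hl : ∀ i j k, g i j k = g j i k) (hr : ∀ i j k, g i j k = g i k j)
    (h0 : ∀ i j, g i i j = 0) :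
    ∑ i, ∑ j, ∑ k, g i j k = 6 * ∑ i, ∑ j ∈ Finset.Ioi i, ∑ k ∈ Finset.Ioi j, g i j k := by
  set G : Fin n → Fin n → Fin n → ℝ := fun i j k => if i < j ∧ j < k then g i j k else 0 with hG
  have hsum : ∑ i, ∑ j ∈ Finset.Ioi i, ∑ k ∈ Finset.Ioi j, g i j k = ∑ i, ∑ j, ∑ k, G i j k := by
    refine Finset.sum_congr rfl fun i _ => ?_
    rw [← Finset.filter_lt_eq_Ioi, Finset.sum_filter]
    refine Finset.sum_congr rfl fun j _ => ?_
    by_cases hij : i < j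
    · rw [if_pos hij, ← Finset.filter_lt_eq_Ioi, Finset.sum_filter]
      exact Finset.sum_congr rfl fun k _ => by simp [hG, hij]
    · simp [hG, hij]
  -- For distinct indices exactly one of the six orderings is increasing; otherwise both sides
  -- vanish.
  have hdec : ∀ i j k, g i j k = G i j k + G i k j + G j i k + G j k i + G k i j + G k j i := by
    intro i j k
    have e1 : g i k j = g i j k := (hr _ _ _).symm
    have e2 : g j i k = g i j k := (hl _ _ _).symm
    have e3 : g j k i = g i j k := by rw [hr, hl]
    have e4 : g k i j = g i j k := by rw [hl, hr]
    have e5 : g k j i = g i j k := by rw [hr, hl, hr]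
    simp only [hG, e1, e2, e3, e4, e5]
    rcases lt_trichotomy i j with h | h | h
    · rcases lt_trichotomy j k with h' | h' | h'
      · simp [h, h', h.not_gt, h'.not_gt, (h.trans h').not_gt]
      · subst h'
        have : g i j j = 0 := by rw [hl, hr, h0]
        simp [this]
      · rcases lt_trichotomy i k with h'' | h'' | h''
        · simp [h, h', h'', h.not_gt, h'.not_gt, h''.not_gt]
        · subst h''
          have : g i j i = 0 := by rw [hr, h0]
          simp [this]
        · simp [h, h', h'', h.not_gt, h'.not_gt, h''.not_gt]
    · subst h
      simp [h0]
    · rcases lt_trichotomy j k with h' | h' | h'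
      · rcases lt_trichotomy i k with h'' | h'' | h''
        · simp [h, h', h'', h.not_gt, h'.not_gt, h''.not_gt]
        · subst h''
          have : g i j i = 0 := by rw [hr, h0]
          simp [this]
        · simp [h, h', h'', h.not_gt, h'.not_gt, h''.not_gt]
      · subst h'
        have : g i j j = 0 := by rw [hl, hr, h0]
        simp [this]
      · simp [h, h', h.not_gt, h'.not_gt, (h'.trans h).not_gt]
  have s1 : ∑ i, ∑ j, ∑ k, G i k j = ∑ i, ∑ j, ∑ k, G i j k :=
    Finset.sum_congr rfl fun i _ => Finset.sum_comm
  have s2 : ∑ i, ∑ j, ∑ k, G j i k = ∑ i, ∑ j, ∑ k, G i j k := Finset.sum_comm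
  have s3 : ∑ i, ∑ j, ∑ k, G j k i = ∑ i, ∑ j, ∑ k, G i j k := by
    rw [Finset.sum_comm]
    exact Finset.sum_congr rfl fun i _ => Finset.sum_comm
  have s4 : ∑ i, ∑ j, ∑ k, G k i j = ∑ i, ∑ j, ∑ k, G i j k := by
    rw [← s2]
    exact Finset.sum_congr rfl fun i _ => Finset.sum_comm
  have s5 : ∑ i, ∑ j, ∑ k, G k j i = ∑ i, ∑ j, ∑ k, G i j k := by
    rw [← s3]
    exact Finset.sum_congr rfl fun i _ => Finset.sum_comm
  rw [hsum]
  simp only [hdec, Finset.sum_add_distrib, s1, s2, s3, s4, s5]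
  ring

theorem tri_eq_six_mul_Fhat {n : ℕ} (v : Fin n → Fin 3 → ℝ) (φ : Fin n → ℝ) :
    tri v φ φ φ = 6 * Fhat v φ := by
  refine sum_eq_six_mul_sum_Ioi _ (fun i j k => ?_) (fun i j k => ?_) fun i j => by simp
  · rw [abs_bracket_swap_left]; ring
  · rw [abs_bracket_swap_right]; ring

theorem smul_segment_zero {E : Type*} [AddCommGroup E] [Module ℝ E] (a : ℝ) (x : E) :
    a • segment ℝ 0 x = segment ℝ 0 (a • x) := by
  have := image_segment ℝ (a • (LinearMap.id : E →ₗ[ℝ] E)).toAffineMap 0 x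
  simpa using this

theorem volume_zonotope {n : ℕ} (v : Fin n → Fin 3 → ℝ) {φ : Fin n → ℝ} (hφ : ∀ i, 0 ≤ φ i) :
    volume (zonotope v φ) = ENNReal.ofReal (Fhat v φ) := by
  have h1 : zonotope v φ = segmentSum Finset.univ fun i => φ i • v i := by
    simp only [zonotope, segmentSum, smul_segment_zero]
  have h2 : Fhat v φ = tri v φ φ φ / 6 := by rw [tri_eq_six_mul_Fhat]; ring
  rw [h1, volume_segmentSum_three, h2]
  congr 2
  refine Finset.sum_congr rfl fun i _ => Finset.sum_congr rfl fun j _ =>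
    Finset.sum_congr rfl fun k _ => ?_
  have h3 : bracket (φ i • v i) (φ j • v j) (φ k • v k)
      = bracket (v i) (v j) (v k) * φ i * φ j * φ k := by
    simp only [bracket_eq, Pi.smul_apply, smul_eq_mul]; ring
  rw [h3, abs_mul, abs_mul, abs_mul, abs_of_nonneg (hφ i), abs_of_nonneg (hφ j),
    abs_of_nonneg (hφ k)]

section Polygon

variable {n : ℕ} {v : Fin n → Fin 3 → ℝ}

/-- The position of `j` when the vertices are enumerated cyclically starting from `i`. -/
def cyclicKey (i j : Fin n) : ℕ := if j < i then j + n else j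

theorem cyclicKey_injective (i : Fin n) : Function.Injective (cyclicKey i) := by
  intro j k h
  have hj := j.2
  have hk := k.2
  ext
  simp only [cyclicKey] at h
  split_ifs at h <;> omega

theorem cyclicKey_self_lt {i j : Fin n} (h : j ≠ i) : cyclicKey i i < cyclicKey i j := by
  have h' : (j : ℕ) ≠ i := fun e => h (Fin.ext e)
  have hi := i.2
  simp only [cyclicKey, Fin.lt_def]
  split_ifs <;> omega

theorem IsConvexPolygon.bracket_pos_of_cyclicKey (hv : IsConvexPolygon v) (i : Fin n)
    {j k l : Fin n} (hjk : cyclicKey i j < cyclicKey i k) (hkl : cyclicKey i k < cyclicKey i l) :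
    0 < bracket (v j) (v k) (v l) := by
  have hj := j.2
  have hk := k.2
  have hl := l.2
  -- Increasing in the enumeration from `i` means increasing up to a cyclic rotation, which leaves
  -- the bracket unchanged.
  have h : (j < k ∧ k < l) ∨ (k < l ∧ l < j) ∨ (l < j ∧ j < k) := by
    simp only [cyclicKey, Fin.lt_def] at *
    split_ifs at * <;> omega
  rcases h with ⟨h1, h2⟩ | ⟨h1, h2⟩ | ⟨h1, h2⟩
  · exact hv.ccw _ _ _ h1 h2
  · rw [bracket_rotate]; exact hv.ccw _ _ _ h1 h2
  · rw [bracket_rotate, bracket_rotate]; exact hv.ccw _ _ _ h1 h2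

theorem IsConvexPolygon.generalPosition (hv : IsConvexPolygon v) : GeneralPosition v := by
  intro i j k hij hik hjk
  have hj := cyclicKey_self_lt hij.symm
  have hk := cyclicKey_self_lt hik.symm
  rcases lt_or_gt_of_ne ((cyclicKey_injective i).ne hjk) with h | h
  · exact (hv.bracket_pos_of_cyclicKey i hj h).ne'
  · rw [bracket_swap]
    exact neg_ne_zero.2 (hv.bracket_pos_of_cyclicKey i hk h).ne'

/-- If the gradient of the cubic form is constant on the support of `φ`, it is larger at each
vertex of the polygon outside this support. -/
theorem IsConvexPolygon.lt_quad_of_eq_zero (hv : IsConvexPolygon v) {φ : Fin n → ℝ}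
    (hφ : ∀ i, 0 ≤ φ i) (h3 : ∃ i j k, i ≠ j ∧ i ≠ k ∧ j ≠ k ∧ φ i ≠ 0 ∧ φ j ≠ 0 ∧ φ k ≠ 0)
    {c : ℝ} (hc : ∀ j, φ j ≠ 0 → quad v j φ φ = c) {i : Fin n} (hi : φ i = 0) :
    c < quad v i φ φ := by
  classical
  set ρ := cyclicKey i with hρ
  have hinj : Function.Injective ρ := cyclicKey_injective i
  have hne : ∀ {j}, φ j ≠ 0 → j ≠ i := fun h e => h (e ▸ hi)
  set S := Finset.univ.filter fun j => φ j ≠ 0 with hS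
  have hmem : ∀ {j}, j ∈ S ↔ φ j ≠ 0 := by simp [hS]
  obtain ⟨j₁, j₂, j₃, h12, h13, h23, hj₁, hj₂, hj₃⟩ := h3
  obtain ⟨b, hb, hbmin⟩ := S.exists_min_image ρ ⟨j₁, hmem.2 hj₁⟩
  obtain ⟨a, ha, hamax⟩ := S.exists_max_image ρ ⟨j₁, hmem.2 hj₁⟩
  -- Counted cyclically from `i`, the support starts at `b` and ends at `a`, with `m` strictly
  -- between. So the line through `v a` and `v b` separates `v m` from `v i`.
  obtain ⟨m, hm, hmb, hma⟩ : ∃ m, φ m ≠ 0 ∧ m ≠ b ∧ m ≠ a := by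
    by_contra! h
    have e1 := h j₁ hj₁
    have e2 := h j₂ hj₂
    have e3 := h j₃ hj₃
    grind
  rw [hmem] at ha hb
  have hbm : ρ b < ρ m := lt_of_le_of_ne (hbmin m (hmem.2 hm)) (hinj.ne hmb.symm)
  have hma' : ρ m < ρ a := lt_of_le_of_ne (hamax m (hmem.2 hm)) (hinj.ne hma)
  have hib : ρ i < ρ b := cyclicKey_self_lt (hne hb)
  let σ : Fin n → Fin n → ℝ := fun j k => if ρ j < ρ k then 1 else -1
  -- A linear minorant of the gradient at the vertices: the absolute values are replaced by the
  -- signs valid as seen from `v i`. These signs remain right at `v b` and `v a` but fail at `v m`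
  -- for the pair `b`, `a`. Thus `Λ` equals `c` at `v a` and `v b`, is below `c` at `v m`, and so
  -- exceeds `c` across the line, at `v i`.
  let Λ : (Fin 3 → ℝ) → ℝ := fun x => ∑ j, ∑ k, σ j k * bracket x (v j) (v k) * φ j * φ k
  have hterm : ∀ y j k, σ j k * bracket (v y) (v j) (v k) * φ j * φ k
      ≤ |bracket (v y) (v j) (v k)| * φ j * φ k := by
    intro y j k
    refine mul_le_mul_of_nonneg_right (mul_le_mul_of_nonneg_right ?_ (hφ j)) (hφ k)
    simp only [σ]
    split_ifs
    · rw [one_mul]; exact le_abs_self _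
    · rw [neg_one_mul]; exact neg_le_abs _
  have heq : ∀ y, (∀ j k, φ j ≠ 0 → φ k ≠ 0 → ρ j < ρ k → 0 ≤ bracket (v y) (v j) (v k)) →
      Λ (v y) = quad v y φ φ := by
    intro y hy
    refine Finset.sum_congr rfl fun j _ => Finset.sum_congr rfl fun k _ => ?_
    by_cases hj : φ j = 0
    · simp [hj]
    by_cases hk : φ k = 0
    · simp [hk]
    congr 2
    simp only [σ]
    split_ifs with h
    · rw [one_mul, abs_of_nonneg (hy j k hj hk h)]
    · rcases (not_lt.1 h).eq_or_lt with h' | h'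
      · rw [hinj h']; simp
      · have := hy k j hk hj h'
        rw [bracket_swap, abs_neg, abs_of_nonneg this]; ring
  have hΛi : Λ (v i) = quad v i φ φ := heq i fun j k hj _ h =>
    (hv.bracket_pos_of_cyclicKey i (cyclicKey_self_lt (hne hj)) h).le
  have hΛb : Λ (v b) = c := by
    rw [← hc b hb]
    refine heq b fun j k hj hk h => ?_
    rcases (hbmin j (hmem.2 hj)).eq_or_lt with h' | h'
    · rw [hinj h']; simp
    · exact (hv.bracket_pos_of_cyclicKey i h' h).le
  have hΛa : Λ (v a) = c := by
    rw [← hc a ha]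
    refine heq a fun j k hj hk h => ?_
    rw [bracket_rotate]
    rcases (hamax k (hmem.2 hk)).eq_or_lt with h' | h'
    · rw [hinj h']; simp
    · exact (hv.bracket_pos_of_cyclicKey i h h').le
  have hΛm : Λ (v m) < c := by
    rw [← hc m hm]
    refine Finset.sum_lt_sum (fun j _ => Finset.sum_le_sum fun k _ => hterm m j k)
      ⟨b, Finset.mem_univ _, Finset.sum_lt_sum (fun k _ => hterm m b k) ⟨a, Finset.mem_univ _, ?_⟩⟩
    have hneg : bracket (v m) (v b) (v a) < 0 := by
      have h1 : bracket (v m) (v b) (v a) = -bracket (v b) (v m) (v a) := by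
        simp only [bracket_eq]; ring
      rw [h1]
      exact neg_neg_of_pos (hv.bracket_pos_of_cyclicKey i hbm hma')
    have hpos : 0 < φ b * φ a := mul_pos ((hφ b).lt_of_ne' hb) ((hφ a).lt_of_ne' ha)
    have hσ : σ b a = 1 := if_pos (hbm.trans hma')
    rw [hσ, one_mul, mul_assoc, mul_assoc]
    exact mul_lt_mul_of_pos_right (hneg.trans (abs_pos.2 hneg.ne)) hpos
  obtain ⟨l, hl⟩ := hv.plane
  have hcramer : bracket (v b) (v m) (v a) • v i = bracket (v i) (v m) (v a) • v b
      - bracket (v i) (v b) (v a) • v m + bracket (v i) (v b) (v m) • v a := by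
    funext t
    fin_cases t <;> simp [bracket_eq] <;> ring
  -- Coplanarity makes the Cramer relation affine, so it can be compared with the constant `c`.
  have hone : bracket (v b) (v m) (v a) = bracket (v i) (v m) (v a)
      - bracket (v i) (v b) (v a) + bracket (v i) (v b) (v m) := by
    have := congrArg l hcramer
    simpa [hl] using this
  have hΛ : bracket (v b) (v m) (v a) * Λ (v i) = bracket (v i) (v m) (v a) * Λ (v b)
      - bracket (v i) (v b) (v a) * Λ (v m) + bracket (v i) (v b) (v m) * Λ (v a) := by
    simp only [Λ, Finset.mul_sum, ← Finset.sum_sub_distrib, ← Finset.sum_add_distrib]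
    refine Finset.sum_congr rfl fun j _ => Finset.sum_congr rfl fun k _ => ?_
    simp only [bracket_eq]
    ring
  have hD := hv.bracket_pos_of_cyclicKey i hbm hma'
  have hγ := hv.bracket_pos_of_cyclicKey i hib (hbm.trans hma')
  rw [hΛi, hΛa, hΛb] at hΛ
  refine lt_of_mul_lt_mul_left ?_ hD.le
  rw [hΛ, hone]
  have := mul_lt_mul_of_pos_left hΛm hγ
  linarith

end Polygon

/-! ### Concavity of the cube root -/

section Concavity

variable {n : ℕ} {v : Fin n → Fin 3 → ℝ}

theorem Fhat_nonneg (v : Fin n → Fin 3 → ℝ) {φ : Fin n → ℝ} (hφ : ∀ i, 0 ≤ φ i) :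
    0 ≤ Fhat v φ := by
  have h1 := tri_nonneg v hφ hφ hφ
  rw [tri_eq_six_mul_Fhat] at h1
  linarith

theorem cbrt_pow {x : ℝ} (hx : 0 ≤ x) : (x ^ (1 / 3 : ℝ)) ^ 3 = x := by
  have := Real.rpow_inv_natCast_pow hx (n := 3) three_ne_zero
  simpa using this

theorem mul_cbrt_le {x y z : ℝ} (hx : 0 ≤ x) (hy : 0 ≤ y) (hz : 0 ≤ z)
    (h : x ^ 2 * y ≤ z ^ 3) : (x ^ (1 / 3 : ℝ)) ^ 2 * y ^ (1 / 3 : ℝ) ≤ z := by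
  refine le_of_pow_le_pow_left₀ three_ne_zero hz ?_
  calc ((x ^ (1 / 3 : ℝ)) ^ 2 * y ^ (1 / 3 : ℝ)) ^ 3
      = ((x ^ (1 / 3 : ℝ)) ^ 3) ^ 2 * (y ^ (1 / 3 : ℝ)) ^ 3 := by ring
    _ ≤ z ^ 3 := by rw [cbrt_pow hx, cbrt_pow hy]; exact h

theorem mul_cbrt_lt {x y z : ℝ} (hx : 0 ≤ x) (hy : 0 ≤ y) (hz : 0 ≤ z)
    (h : x ^ 2 * y < z ^ 3) : (x ^ (1 / 3 : ℝ)) ^ 2 * y ^ (1 / 3 : ℝ) < z := by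
  refine lt_of_pow_lt_pow_left₀ 3 hz ?_
  calc ((x ^ (1 / 3 : ℝ)) ^ 2 * y ^ (1 / 3 : ℝ)) ^ 3
      = ((x ^ (1 / 3 : ℝ)) ^ 3) ^ 2 * (y ^ (1 / 3 : ℝ)) ^ 3 := by ring
    _ < z ^ 3 := by rw [cbrt_pow hx, cbrt_pow hy]; exact h

theorem Fhat_tangent_lt (hv : GeneralPosition v) {φ ψ : Fin n → ℝ} (hφ : ∀ i, 0 ≤ φ i)
    (h3 : ∃ i j k, i ≠ j ∧ i ≠ k ∧ j ≠ k ∧ φ i ≠ 0 ∧ φ j ≠ 0 ∧ φ k ≠ 0) (hψ : ∀ i, 0 ≤ ψ i)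
    (hsupp : ∀ i, φ i = 0 → ψ i = 0) (hne : ∀ c : ℝ, ψ ≠ c • φ) :
    Fhat v φ ^ 2 * Fhat v ψ < (tri v φ φ ψ / 6) ^ 3 := by
  have := tri_tangent_lt hv hφ h3 hψ hsupp hne
  simp only [tri_eq_six_mul_Fhat] at this
  linarith

theorem Fhat_tangent_le (hv : GeneralPosition v) {φ ψ : Fin n → ℝ} (hφ : ∀ i, 0 ≤ φ i)
    (h3 : ∃ i j k, i ≠ j ∧ i ≠ k ∧ j ≠ k ∧ φ i ≠ 0 ∧ φ j ≠ 0 ∧ φ k ≠ 0) (hψ : ∀ i, 0 ≤ ψ i)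
    (hsupp : ∀ i, φ i = 0 → ψ i = 0) :
    Fhat v φ ^ 2 * Fhat v ψ ≤ (tri v φ φ ψ / 6) ^ 3 := by
  by_cases hne : ∀ c : ℝ, ψ ≠ c • φ
  · exact (Fhat_tangent_lt hv hφ h3 hψ hsupp hne).le
  · push Not at hne
    obtain ⟨c, rfl⟩ := hne
    have h1 := tri_eq_six_mul_Fhat v (c • φ)
    simp only [tri_smul_left, tri_smul_mid, tri_smul_right, tri_eq_six_mul_Fhat] at h1 ⊢
    have h2 : Fhat v (c • φ) = c * (c * (c * Fhat v φ)) := by linarith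
    rw [h2]
    apply le_of_eq
    ring

theorem supp_of_add {a b : Fin n → ℝ} (ha : ∀ i, 0 ≤ a i) (hb : ∀ i, 0 ≤ b i) {s t : ℝ}
    (hs : 0 < s) (ht : 0 < t) (i : Fin n) (h : (s • a + t • b) i = 0) : a i = 0 ∧ b i = 0 := by
  simp only [Pi.add_apply, Pi.smul_apply, smul_eq_mul] at h
  have h1 := mul_nonneg hs.le (ha i)
  have h2 := mul_nonneg ht.le (hb i)
  exact ⟨(mul_eq_zero.1 (by linarith)).resolve_left hs.ne',
    (mul_eq_zero.1 (by linarith)).resolve_left ht.ne'⟩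

theorem nonneg_of_add {a b : Fin n → ℝ} (ha : ∀ i, 0 ≤ a i) (hb : ∀ i, 0 ≤ b i) {s t : ℝ}
    (hs : 0 < s) (ht : 0 < t) (i : Fin n) : 0 ≤ (s • a + t • b) i :=
  add_nonneg (mul_nonneg hs.le (ha i)) (mul_nonneg ht.le (hb i))

theorem exists_three_of_Fhat_pos {φ : Fin n → ℝ} (h : 0 < Fhat v φ) :
    ∃ i j k, i ≠ j ∧ i ≠ k ∧ j ≠ k ∧ φ i ≠ 0 ∧ φ j ≠ 0 ∧ φ k ≠ 0 :=
  exists_three_of_tri_ne_zero v (by rw [tri_eq_six_mul_Fhat]; linarith)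

theorem Fhat_pos_of_exists_three (hv : GeneralPosition v) {φ : Fin n → ℝ} (hφ : ∀ i, 0 ≤ φ i)
    (h3 : ∃ i j k, i ≠ j ∧ i ≠ k ∧ j ≠ k ∧ φ i ≠ 0 ∧ φ j ≠ 0 ∧ φ k ≠ 0) : 0 < Fhat v φ := by
  obtain ⟨i, j, k, hij, hik, hjk, hi, hj, hk⟩ := h3
  have := tri_pos_of_ne v hv hφ hφ hφ hij hik hjk hi hj hk
  rw [tri_eq_six_mul_Fhat] at this
  linarith

/-- Linearity in the last slot alone. Each summand is then bounded below by the tangent inequality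
at the mixture, which yields concavity. -/
theorem Fhat_eq_split (v : Fin n → Fin 3 → ℝ) (a b : Fin n → ℝ) (s t : ℝ) :
    Fhat v (s • a + t • b) = s * (tri v (s • a + t • b) (s • a + t • b) a / 6)
      + t * (tri v (s • a + t • b) (s • a + t • b) b / 6) := by
  have h := tri_eq_six_mul_Fhat v (s • a + t • b)
  rw [tri_add_right, tri_smul_right, tri_smul_right] at h
  linarith

theorem cbrt_Fhat_concave (hv : GeneralPosition v) {a b : Fin n → ℝ} (ha : ∀ i, 0 ≤ a i)
    (hb : ∀ i, 0 ≤ b i) {s t : ℝ} (hs : 0 < s) (ht : 0 < t) :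
    s * Fhat v a ^ (1 / 3 : ℝ) + t * Fhat v b ^ (1 / 3 : ℝ)
      ≤ Fhat v (s • a + t • b) ^ (1 / 3 : ℝ) := by
  set φ := s • a + t • b with hφdef
  have hφ : ∀ i, 0 ≤ φ i := nonneg_of_add ha hb hs ht
  have hsa : ∀ i, φ i = 0 → a i = 0 := fun i h => (supp_of_add ha hb hs ht i h).1
  have hsb : ∀ i, φ i = 0 → b i = 0 := fun i h => (supp_of_add ha hb hs ht i h).2
  by_cases h3 : ∃ i j k, i ≠ j ∧ i ≠ k ∧ j ≠ k ∧ φ i ≠ 0 ∧ φ j ≠ 0 ∧ φ k ≠ 0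
  · have hF := Fhat_pos_of_exists_three hv hφ h3
    have h1 := mul_cbrt_le hF.le (Fhat_nonneg v ha) (div_nonneg (tri_nonneg v hφ hφ ha) (by norm_num))
      (Fhat_tangent_le hv hφ h3 ha hsa)
    have h2 := mul_cbrt_le hF.le (Fhat_nonneg v hb) (div_nonneg (tri_nonneg v hφ hφ hb) (by norm_num))
      (Fhat_tangent_le hv hφ h3 hb hsb)
    have hc := cbrt_pow hF.le
    have hc0 : 0 < Fhat v φ ^ (1 / 3 : ℝ) := Real.rpow_pos_of_pos hF _
    have hsplit : Fhat v φ = _ := Fhat_eq_split v a b s t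
    have h4 := mul_le_mul_of_nonneg_left h1 hs.le
    have h5 := mul_le_mul_of_nonneg_left h2 ht.le
    refine le_of_mul_le_mul_left ?_ (pow_pos hc0 2)
    calc _ = s * ((Fhat v φ ^ (1 / 3 : ℝ)) ^ 2 * Fhat v a ^ (1 / 3 : ℝ))
          + t * ((Fhat v φ ^ (1 / 3 : ℝ)) ^ 2 * Fhat v b ^ (1 / 3 : ℝ)) := by ring
      _ ≤ Fhat v φ := (add_le_add h4 h5).trans_eq hsplit.symm
      _ = _ := by rw [← pow_succ, hc]
  -- With at most two indices in the support of `φ`, all three values of the form vanish.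
  · have hzero : ∀ c : Fin n → ℝ, (∀ i, 0 ≤ c i) → (∀ i, φ i = 0 → c i = 0) → Fhat v c = 0 := by
      intro c hc hsc
      by_contra hne
      obtain ⟨i, j, k, hij, hik, hjk, hi, hj, hk⟩ :=
        exists_three_of_Fhat_pos ((Fhat_nonneg v hc).lt_of_ne' hne)
      exact h3 ⟨i, j, k, hij, hik, hjk, fun h => hi (hsc i h), fun h => hj (hsc j h),
        fun h => hk (hsc k h)⟩
    rw [hzero a ha hsa, hzero b hb hsb, hzero φ hφ fun i h => h]
    simp

theorem cbrt_Fhat_strictConcave (hv : GeneralPosition v) {r : ℝ} (hr : 0 < r) {a b : Fin n → ℝ}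
    (ha : a ∈ Gam n r) (hb : b ∈ Gam n r) (hab : a ≠ b) {s t : ℝ} (hs : 0 < s) (ht : 0 < t)
    (hst : s + t = 1) (h3 : ∃ i j k, i ≠ j ∧ i ≠ k ∧ j ≠ k ∧ (s • a + t • b) i ≠ 0 ∧
      (s • a + t • b) j ≠ 0 ∧ (s • a + t • b) k ≠ 0) :
    s * Fhat v a ^ (1 / 3 : ℝ) + t * Fhat v b ^ (1 / 3 : ℝ)
      < Fhat v (s • a + t • b) ^ (1 / 3 : ℝ) := by
  obtain ⟨ha, har⟩ := ha
  obtain ⟨hb, hbr⟩ := hb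
  set φ := s • a + t • b with hφdef
  have hφ : ∀ i, 0 ≤ φ i := nonneg_of_add ha hb hs ht
  have hsa : ∀ i, φ i = 0 → a i = 0 := fun i h => (supp_of_add ha hb hs ht i h).1
  have hsb : ∀ i, φ i = 0 → b i = 0 := fun i h => (supp_of_add ha hb hs ht i h).2
  have hφr : ∑ i, φ i = r := by
    simp only [hφdef, Pi.add_apply, Pi.smul_apply, smul_eq_mul, Finset.sum_add_distrib,
      ← Finset.mul_sum, har, hbr]
    rw [← add_mul, hst, one_mul]
  have hF := Fhat_pos_of_exists_three hv hφ h3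
  -- Equal coordinate sums would force `c = 1`, hence `a = φ` and `a = b`. Strictness for `a` alone
  -- suffices.
  have hnea : ∀ c : ℝ, a ≠ c • φ := by
    intro c hc
    have h1 : ∑ i, a i = c * r := by
      rw [hc, ← hφr, Finset.mul_sum]; rfl
    have h2 : c = 1 := by
      rw [har] at h1
      exact (mul_right_cancel₀ hr.ne' (by linarith : c * r = 1 * r))
    rw [h2, one_smul] at hc
    refine hab (funext fun i => ?_)
    have h4 := congrFun hc i
    simp only [hφdef, Pi.add_apply, Pi.smul_apply, smul_eq_mul] at h4
    have h5 : t * (a i - b i) = 0 := by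
      have : s = 1 - t := by linarith
      rw [this] at h4
      linarith
    exact sub_eq_zero.1 ((mul_eq_zero.1 h5).resolve_left ht.ne')
  have h1 := mul_cbrt_lt hF.le (Fhat_nonneg v ha) (div_nonneg (tri_nonneg v hφ hφ ha) (by norm_num))
    (Fhat_tangent_lt hv hφ h3 ha hsa hnea)
  have h2 := mul_cbrt_le hF.le (Fhat_nonneg v hb) (div_nonneg (tri_nonneg v hφ hφ hb) (by norm_num))
    (Fhat_tangent_le hv hφ h3 hb hsb)
  have hc := cbrt_pow hF.le
  have hc0 : 0 < Fhat v φ ^ (1 / 3 : ℝ) := Real.rpow_pos_of_pos hF _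
  have hsplit : Fhat v φ = _ := Fhat_eq_split v a b s t
  have h4 := mul_lt_mul_of_pos_left h1 hs
  have h5 := mul_le_mul_of_nonneg_left h2 ht.le
  refine lt_of_mul_lt_mul_left ?_ (pow_pos hc0 2).le
  calc _ = s * ((Fhat v φ ^ (1 / 3 : ℝ)) ^ 2 * Fhat v a ^ (1 / 3 : ℝ))
        + t * ((Fhat v φ ^ (1 / 3 : ℝ)) ^ 2 * Fhat v b ^ (1 / 3 : ℝ)) := by ring
    _ < Fhat v φ := (add_lt_add_of_lt_of_le h4 h5).trans_eq hsplit.symm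
    _ = _ := by rw [← pow_succ, hc]

theorem exists_three_of_not_onCommonEdge (hn : 3 ≤ n) {a b φ : Fin n → ℝ}
    (h : ¬ OnCommonEdge a b) (hφ : ∀ i, φ i = 0 → a i = 0 ∧ b i = 0) :
    ∃ i j k, i ≠ j ∧ i ≠ k ∧ j ≠ k ∧ φ i ≠ 0 ∧ φ j ≠ 0 ∧ φ k ≠ 0 := by
  have step : ∀ i j, ∃ k, k ≠ i ∧ k ≠ j ∧ φ k ≠ 0 := by
    intro i j
    by_contra! hcon
    exact h ⟨i, j, fun k hi hj => hφ k (hcon k hi hj)⟩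
  obtain ⟨i, -, -, hi⟩ := step ⟨0, by omega⟩ ⟨0, by omega⟩
  obtain ⟨j, hji, -, hj⟩ := step i i
  obtain ⟨k, hki, hkj, hk⟩ := step i j
  exact ⟨i, j, k, hji.symm, hki.symm, hkj.symm, hi, hj, hk⟩

end Concavity

/-! ### Critical points and local maxima -/

section Critical

variable {n : ℕ} {v : Fin n → Fin 3 → ℝ} {r : ℝ}

theorem differentiable_Fhat (v : Fin n → Fin 3 → ℝ) : Differentiable ℝ (Fhat v) := by
  unfold Fhat
  fun_prop

theorem Fhat_line (v : Fin n → Fin 3 → ℝ) (φ w : Fin n → ℝ) (t : ℝ) :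
    Fhat v (φ + t • w) = Fhat v φ + t * (tri v φ φ w / 2) + t ^ 2 * (tri v φ w w / 2)
      + t ^ 3 * Fhat v w := by
  have h := tri_line v φ w t
  simp only [tri_eq_six_mul_Fhat] at h
  linarith

theorem fderiv_Fhat (v : Fin n → Fin 3 → ℝ) (φ w : Fin n → ℝ) :
    fderiv ℝ (Fhat v) φ w = tri v φ φ w / 2 := by
  rw [← (differentiable_Fhat v φ).lineDeriv_eq_fderiv]
  refine HasLineDerivAt.lineDeriv ?_
  unfold HasLineDerivAt
  simp only [Fhat_line]
  have h1 : HasDerivAt (fun t : ℝ => t) 1 0 := hasDerivAt_id 0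
  exact ((((h1.mul_const (tri v φ φ w / 2)).const_add (Fhat v φ)).add
    ((h1.pow 2).mul_const (tri v φ w w / 2))).add ((h1.pow 3).mul_const (Fhat v w))).congr_deriv
    (by simp)

theorem convex_Gam (n : ℕ) (r : ℝ) : Convex ℝ (Gam n r) := by
  rintro a ⟨ha, har⟩ b ⟨hb, hbr⟩ s t hs ht hst
  refine ⟨fun i => add_nonneg (mul_nonneg hs (ha i)) (mul_nonneg ht (hb i)), ?_⟩
  simp only [Pi.add_apply, Pi.smul_apply, smul_eq_mul, Finset.sum_add_distrib,
    ← Finset.mul_sum, har, hbr]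
  rw [← add_mul, hst, one_mul]

theorem single_mem_Gam (hr : 0 ≤ r) (i : Fin n) : Pi.single i r ∈ Gam n r := by
  refine ⟨fun j => ?_, by simp⟩
  rcases eq_or_ne j i with rfl | h
  · simpa
  · simp [h]

theorem exists_mem_relintGam (hn : 0 < n) (hr : 0 < r) : ∃ c, c ∈ relintGam n r := by
  have hn' : (0 : ℝ) < n := Nat.cast_pos.2 hn
  refine ⟨fun _ => r / n, fun _ => div_pos hr hn', ?_⟩
  simp only [Finset.sum_const, Finset.card_univ, Fintype.card_fin, nsmul_eq_mul]
  field_simp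

theorem Fhat_pos_of_pos (hv : IsConvexPolygon v) {φ : Fin n → ℝ} (hφ : ∀ i, 0 < φ i) :
    0 < Fhat v φ := by
  have h := tri_pos_of_card hv.generalPosition (by simpa using hv.three_le) hφ
  rw [tri_eq_six_mul_Fhat] at h
  linarith

theorem tri_single_right (v : Fin n → Fin 3 → ℝ) (φ : Fin n → ℝ) (i : Fin n) (r : ℝ) :
    tri v φ φ (Pi.single i r) = r * quad v i φ φ := by
  rw [tri_swap_right, tri_swap_left, tri_eq_sum_quad]
  simp [Pi.single_apply]

theorem IsCriticalOrLocalMax.mem_Gam {φ : Fin n → ℝ} (h : IsCriticalOrLocalMax v r φ) :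
    φ ∈ Gam n r := by
  rcases h with h | h
  exacts [h.1.1, h.1]

/-- The only first-order information used: the derivative from `φ` towards `ψ` is nonpositive, for
either kind of point. -/
theorem IsCriticalOrLocalMax.tri_le {φ ψ : Fin n → ℝ} (h : IsCriticalOrLocalMax v r φ)
    (hψ : ψ ∈ Gam n r) : tri v φ φ ψ ≤ tri v φ φ φ := by
  have hsub : fderiv ℝ (Fhat v) φ (ψ - φ) ≤ 0 := by
    rcases h with ⟨⟨hφ, hc⟩, -⟩ | ⟨hφ, hmax⟩
    · refine (hc _ ?_).le
      simp [Finset.sum_sub_distrib, hψ.2, hφ.2]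
    · exact hmax.hasFDerivWithinAt_nonpos
        (differentiable_Fhat v φ).hasFDerivAt.hasFDerivWithinAt
        (sub_mem_posTangentConeAt_of_segment_subset ((convex_Gam n r).segment_subset hφ hψ))
  rw [fderiv_Fhat, sub_eq_add_neg, ← neg_one_smul ℝ φ, tri_add_right, tri_smul_right] at hsub
  linarith

theorem IsCriticalOrLocalMax.Fhat_pos (hv : IsConvexPolygon v) (hr : 0 < r) {φ : Fin n → ℝ}
    (h : IsCriticalOrLocalMax v r φ) : 0 < Fhat v φ := by
  obtain ⟨hφ, hφr⟩ := h.mem_Gam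
  have hn : 3 ≤ Fintype.card (Fin n) := by simpa using hv.three_le
  obtain ⟨c, hc, hcr⟩ := exists_mem_relintGam (n := n) (by have := hv.three_le; omega) hr
  have hcG : c ∈ Gam n r := ⟨fun i => (hc i).le, hcr⟩
  rcases h with h | ⟨hG, hmax⟩
  · obtain ⟨i, hi⟩ : ∃ i, φ i ≠ 0 := by
      by_contra! h0
      rw [Finset.sum_eq_zero fun i _ => h0 i] at hφr
      exact hr.ne hφr
    -- This is where vertices of the simplex are excluded. Two nonzero coordinates make `tri v φ φ
    -- c` positive for an interior `c`, and `tri_le` bounds it by `tri v φ φ φ`.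
    obtain ⟨j, hji, hj⟩ : ∃ j, j ≠ i ∧ φ j ≠ 0 := by
      by_contra! h0
      refine h.2 i (funext fun j => ?_)
      rcases eq_or_ne j i with rfl | hj
      · rw [Pi.single_eq_same, ← hφr, Finset.sum_eq_single j (fun k _ hk => h0 k hk) (by simp)]
      · rw [Pi.single_eq_of_ne hj, h0 j hj]
    obtain ⟨k, hki, hkj⟩ := exists_ne_ne hn i j
    have h1 := tri_pos_of_ne v hv.generalPosition hφ hφ hcG.1 hji.symm hki.symm hkj.symm hi hj
      (hc k).ne'
    have h2 := IsCriticalOrLocalMax.tri_le (Or.inl h) hcG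
    rw [tri_eq_six_mul_Fhat v φ] at h2
    linarith
  -- Moving slightly towards an interior point gives positive values arbitrarily close to `φ`, and a
  -- local maximum is at least as large.
  · have hlim : Filter.Tendsto (fun t : ℝ => φ + t • (c - φ)) (nhdsWithin 0 (Set.Ioo 0 1))
        (nhdsWithin φ (Gam n r)) := by
      refine tendsto_nhdsWithin_iff.2 ⟨?_, Filter.eventually_of_mem self_mem_nhdsWithin ?_⟩
      · refine Filter.Tendsto.mono_left ?_ nhdsWithin_le_nhds
        exact Continuous.tendsto' (by fun_prop) _ _ (by simp)
      · intro t ht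
        exact (convex_Gam n r).add_smul_sub_mem hG hcG ⟨ht.1.le, ht.2.le⟩
    have hmem : ∀ᶠ t : ℝ in nhdsWithin 0 (Set.Ioo 0 1), t ∈ Set.Ioo (0 : ℝ) 1 :=
      self_mem_nhdsWithin
    have hbot : (nhdsWithin (0 : ℝ) (Set.Ioo 0 1)).NeBot := by
      rw [nhdsWithin_Ioo_eq_nhdsGT zero_lt_one]; infer_instance
    obtain ⟨t, ht, ht01⟩ := ((hlim.eventually hmax).and hmem).exists
    refine (Fhat_pos_of_pos hv fun i => ?_).trans_le ht
    have h1 := mul_pos ht01.1 (hc i)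
    have h2 := mul_nonneg (sub_nonneg.2 ht01.2.le) (hφ i)
    simp only [Pi.add_apply, Pi.smul_apply, Pi.sub_apply, smul_eq_mul]
    linarith

/-- Complementary slackness: testing against the vertices of the simplex bounds all `quad v i φ φ`
by their `φ`-average `c`, so equality holds on the support. A vanishing coordinate would then
contradict `lt_quad_of_eq_zero`. -/
theorem IsCriticalOrLocalMax.pos_and_quad_eq (hv : IsConvexPolygon v) (hr : 0 < r)
    {φ : Fin n → ℝ} (h : IsCriticalOrLocalMax v r φ) :
    (∀ i, 0 < φ i) ∧ ∀ i, quad v i φ φ = tri v φ φ φ / r := by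
  obtain ⟨hφ, hφr⟩ := h.mem_Gam
  set c := tri v φ φ φ / r with hc
  have hle : ∀ i, quad v i φ φ ≤ c := fun i => by
    have h1 := h.tri_le (single_mem_Gam hr.le i)
    rw [tri_single_right] at h1
    rw [hc, le_div_iff₀ hr]
    linarith
  have hnn : ∀ i ∈ Finset.univ, 0 ≤ φ i * (c - quad v i φ φ) := fun i _ =>
    mul_nonneg (hφ i) (sub_nonneg.2 (hle i))
  have hsum : ∑ i, φ i * (c - quad v i φ φ) = 0 := by
    simp only [mul_sub, Finset.sum_sub_distrib, ← Finset.sum_mul, hφr]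
    rw [← tri_eq_sum_quad, hc]
    field_simp
    ring
  have heq : ∀ i, φ i ≠ 0 → quad v i φ φ = c := fun i hi => by
    have := (Finset.sum_eq_zero_iff_of_nonneg hnn).1 hsum i (Finset.mem_univ i)
    exact (sub_eq_zero.1 ((mul_eq_zero.1 this).resolve_left hi)).symm
  have hpos : ∀ i, φ i ≠ 0 := fun i hi =>
    (hle i).not_gt (hv.lt_quad_of_eq_zero hφ (exists_three_of_Fhat_pos (h.Fhat_pos hv hr)) heq hi)
  exact ⟨fun i => (hφ i).lt_of_ne' (hpos i), fun i => heq i (hpos i)⟩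

theorem IsCriticalOrLocalMax.isCritical (hv : IsConvexPolygon v) (hr : 0 < r)
    {φ : Fin n → ℝ} (h : IsCriticalOrLocalMax v r φ) : IsCritical v r φ := by
  refine ⟨h.mem_Gam, fun w hw => ?_⟩
  rw [fderiv_Fhat, tri_swap_right, tri_swap_left, tri_eq_sum_quad]
  simp only [(h.pos_and_quad_eq hv hr).2, ← Finset.sum_mul, hw, zero_mul, zero_div]

theorem IsCriticalOrLocalMax.Fhat_lt (hv : IsConvexPolygon v) (hr : 0 < r)
    {φ ψ : Fin n → ℝ} (h : IsCriticalOrLocalMax v r φ) (hψ : ψ ∈ Gam n r) (hne : ψ ≠ φ) :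
    Fhat v ψ < Fhat v φ := by
  have hpos := (h.pos_and_quad_eq hv hr).1
  have hF := h.Fhat_pos hv hr
  have hprop : ∀ c : ℝ, ψ ≠ c • φ := by
    intro c hc
    have h1 : ∑ i, ψ i = c * ∑ i, φ i := by rw [hc, Finset.mul_sum]; rfl
    rw [hψ.2, h.mem_Gam.2] at h1
    have h2 : c = 1 := mul_right_cancel₀ hr.ne' (by linarith : c * r = 1 * r)
    exact hne (by rw [hc, h2, one_smul])
  have h1 := Fhat_tangent_lt hv.generalPosition h.mem_Gam.1 (exists_three_of_Fhat_pos hF) hψ.1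
    (fun i hi => absurd hi (hpos i).ne') hprop
  have h2 := h.tri_le hψ
  rw [tri_eq_six_mul_Fhat v φ] at h2
  have h3 : (tri v φ φ ψ / 6) ^ 3 ≤ Fhat v φ ^ 3 :=
    pow_le_pow_left₀ (div_nonneg (tri_nonneg v h.mem_Gam.1 h.mem_Gam.1 hψ.1) (by norm_num))
      (by linarith) 3
  refine lt_of_mul_lt_mul_left ?_ (pow_pos hF 2).le
  calc _ < _ := h1
    _ ≤ _ := h3
    _ = _ := by ring

end Critical

end ToricZonotope

theorem mainTheorem6 {n : ℕ} (v : Fin n → Fin 3 → ℝ) (hv : ToricZonotope.IsConvexPolygon v)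
    (r : ℝ) (hr : 0 < r) :
    -- the cubic form is the volume of the zonotope
    (∀ φ ∈ ToricZonotope.orthant n,
      volume (ToricZonotope.zonotope v φ) = ENNReal.ofReal (ToricZonotope.Fhat v φ) ∧
      0 ≤ ToricZonotope.Fhat v φ) ∧
    -- its cube root is concave on the nonnegative orthant
    ConcaveOn ℝ (ToricZonotope.orthant n)
      (fun φ => ToricZonotope.Fhat v φ ^ (1 / 3 : ℝ)) ∧
    -- strict concavity on the simplex, off the segments contained in its edges
    (∀ a ∈ ToricZonotope.Gam n r, ∀ b ∈ ToricZonotope.Gam n r, a ≠ b →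
      ¬ ToricZonotope.OnCommonEdge a b → ∀ t : ℝ, 0 < t → t < 1 →
        (1 - t) * ToricZonotope.Fhat v a ^ (1 / 3 : ℝ) + t * ToricZonotope.Fhat v b ^ (1 / 3 : ℝ)
          < ToricZonotope.Fhat v ((1 - t) • a + t • b) ^ (1 / 3 : ℝ)) ∧
    -- in particular on the relative interior, indeed wherever the volume is nonzero
    ToricZonotope.relintGam n r ⊆
      {φ | φ ∈ ToricZonotope.Gam n r ∧ 0 < ToricZonotope.Fhat v φ} ∧
    StrictConcaveOn ℝ {φ | φ ∈ ToricZonotope.Gam n r ∧ 0 < ToricZonotope.Fhat v φ}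
      (fun φ => ToricZonotope.Fhat v φ ^ (1 / 3 : ℝ)) ∧
    -- critical points and local maxima
    (∀ φ : Fin n → ℝ, ToricZonotope.IsCriticalOrLocalMax v r φ →
      φ ∈ ToricZonotope.relintGam n r ∧
      ToricZonotope.IsCritical v r φ ∧
      (∀ ψ, ToricZonotope.IsCriticalOrLocalMax v r ψ → ψ = φ) ∧
      (∀ ψ ∈ ToricZonotope.Gam n r, ψ ≠ φ →
        ToricZonotope.Fhat v ψ < ToricZonotope.Fhat v φ)) := by
  have hgp := hv.generalPosition
  have hpos : ∀ a b : Fin n → ℝ, a ∈ ToricZonotope.Gam n r → 0 < ToricZonotope.Fhat v a →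
      b ∈ ToricZonotope.Gam n r → ∀ s t : ℝ, 0 < s → 0 < t →
      ∃ i j k, i ≠ j ∧ i ≠ k ∧ j ≠ k ∧ (s • a + t • b) i ≠ 0 ∧
        (s • a + t • b) j ≠ 0 ∧ (s • a + t • b) k ≠ 0 := by
    intro a b ha hFa hb s t hs ht
    obtain ⟨i, j, k, hij, hik, hjk, hi, hj, hk⟩ := ToricZonotope.exists_three_of_Fhat_pos hFa
    have hsupp := ToricZonotope.supp_of_add ha.1 hb.1 hs ht
    exact ⟨i, j, k, hij, hik, hjk, fun h => hi (hsupp i h).1, fun h => hj (hsupp j h).1,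
      fun h => hk (hsupp k h).1⟩
  refine ⟨fun φ hφ => ⟨ToricZonotope.volume_zonotope v hφ, ToricZonotope.Fhat_nonneg v hφ⟩,
    ?_, ?_, ?_, ?_, ?_⟩
  · refine concaveOn_iff_forall_pos.2 ⟨?_, fun a ha b hb s t hs ht _ => ?_⟩
    · intro a ha b hb s t hs ht _ i
      exact add_nonneg (mul_nonneg hs (ha i)) (mul_nonneg ht (hb i))
    · exact ToricZonotope.cbrt_Fhat_concave hgp ha hb hs ht
  · intro a ha b hb hab hedge t ht0 ht1
    have hs : 0 < 1 - t := sub_pos.2 ht1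
    exact ToricZonotope.cbrt_Fhat_strictConcave hgp hr ha hb hab hs ht0 (by ring)
      (ToricZonotope.exists_three_of_not_onCommonEdge hv.three_le hedge
        (ToricZonotope.supp_of_add ha.1 hb.1 hs ht0))
  · rintro φ ⟨hφ, hφr⟩
    exact ⟨⟨fun i => (hφ i).le, hφr⟩, ToricZonotope.Fhat_pos_of_pos hv hφ⟩
  · refine ⟨convex_iff_forall_pos.2 ?_, ?_⟩
    · rintro a ⟨ha, hFa⟩ b ⟨hb, -⟩ s t hs ht hst
      have hG := ToricZonotope.convex_Gam n r ha hb hs.le ht.le hst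
      exact ⟨hG, ToricZonotope.Fhat_pos_of_exists_three hgp hG.1 (hpos a b ha hFa hb s t hs ht)⟩
    · rintro a ⟨ha, hFa⟩ b ⟨hb, -⟩ hab s t hs ht hst
      exact ToricZonotope.cbrt_Fhat_strictConcave hgp hr ha hb hab hs ht hst
        (hpos a b ha hFa hb s t hs ht)
  · intro φ h
    refine ⟨⟨(h.pos_and_quad_eq hv hr).1, h.mem_Gam.2⟩, h.isCritical hv hr, fun ψ h' => ?_,
      fun ψ hψ hne => h.Fhat_lt hv hr hψ hne⟩
    -- Two distinct such points would each have a strictly larger value than the other.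
    by_contra hne
    exact lt_asymm (h.Fhat_lt hv hr h'.mem_Gam hne) (h'.Fhat_lt hv hr h.mem_Gam (Ne.symm hne))
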